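/- Let $r,s:\mathbb{Z}\to\mathbb{R}$ satisfy $r(0)=s(0)=1$ and $s\in\ell^2(\mathbb{Z})$, and let $(X_{ij})_{i,j\ge 1}$ be a centered jointly Gaussian family of real random variables with $\mathbb{E}[X_{ij}X_{i'j'}]=r(i-i')\,s(j-j')$ for all $i,j,i',j'\ge1$. For integers $n,d\ge 1$ let $\widetilde{\mathcal W}_{n,d}=(\widetilde W_{ij})_{1\le i,j\le n}$ be the shifted Wishart matrix $$\widetilde W_{ij}=\frac1{\sqrt d}\sum_{k=1}^d\big(X_{ik}X_{jk}-r(i-j)\big),$$ and let $\mathcal G_{n,d}^{(r,s)}=(G_{ij})_{1\le i,j\le n}$ be a random symmetric matrix whose entries are jointly Gaussian and centered, with the same covariances as the entries of $\widetilde{\mathcal W}_{n,d}$. For a symmetric $n\times n$ matrix $M$, let $M^{\rm half}=(M_{ij})_{1\le i\le j\le n}\in\mathbb{R}^{n(n+1)/2}$ be the vector of its upper-triangular entries (diagonal included). For random vectors $U,V$ in $\mathbb{R}^m$ with square-integrable components put $$d_2(U,V)=\sup_{\|h''\|_\infty\le1}\big|\mathbb{E}[h(U)]-\mathbb{E}[h(V)]\big|,\qquad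 \widetilde{d_2}(U,V)=\sup_{M_2(h)\le1}\big|\mathbb{E}[h(U)]-\mathbb{E}[h(V)]\big|,$$ where $h$ ranges over $C^2(\mathbb{R}^m)$, $\|h''\|_\infty=\sup_{x,i,j}\big|\tfrac{\partial^2h}{\partial x_i\partial x_j}(x)\big|$, and $M_2(h)=\sup_x\|D^2h(x)\|_{\rm op}$ (operator norm for the Euclidean norm). Write $$d_2=d_2\big((\widetilde{\mathcal W}_{n,d})^{\rm half},(\mathcal G_{n,d}^{(r,s)})^{\rm half}\big),\quad \widetilde{d_2}=\widetilde{d_2}\big((\widetilde{\mathcal W}_{n,d})^{\rm half},(\mathcal G_{n,d}^{(r,s)})^{\rm half}\big),\quad S_d=\sum_{|k|\le d}|s(k)|^{4/3}.$$ Then, for all $n,d\ge1$: 1. $d_2\le C_1\,\dfrac{n^4}{\sqrt d}\,S_d^{3/2}$ and $\widetilde{d_2}\le C_1\,\dfrac{n^3}{\sqrt d}\,S_d^{3/2}$, where $C_1$ is an absolute constant; 2. if in addition $r\in\ell^2(\mathbb{Z})$, then $d_2\le C_2\,\dfrac{n^{7/2}}{\sqrt d}\,S_d^{3/2}$ and $\widetilde{d_2}\le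 C_2\,\dfrac{n^{5/2}}{\sqrt d}\,S_d^{3/2}$, where $C_2$ depends only on $r$; 3. if in addition $r\in\ell^1(\mathbb{Z})$, then $d_2\le C_3\,\dfrac{n^{3}}{\sqrt d}\,S_d^{3/2}$ and $\widetilde{d_2}\le C_3\,\dfrac{n^{5/2}}{\sqrt d}\,S_d^{3/2}$, where $C_3$ depends only on $r$. -/

import Mathlib

open MeasureTheory ProbabilityTheory
open scoped ENNReal

noncomputable section

namespace WishartOverall

/-- A Gaussian array: the `X i j` (row `i`, column `j`) are jointly Gaussian, centered, and
`Cov(X i j, X i' j') = r (i - i') * s (j - j')`. Rows and columns are numbered from `0`,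
which leaves all differences of indices unchanged. -/
structure IsGaussianArray {Ω : Type*} [MeasurableSpace Ω] (P : Measure Ω) (r s : ℤ → ℝ)
    (X : ℕ → ℕ → Ω → ℝ) : Prop where
  gaussian : IsGaussianProcess (fun p : ℕ × ℕ => X p.1 p.2) P
  centered : ∀ i j, ∫ ω, X i j ω ∂P = 0
  cov_eq : ∀ i j i' j' : ℕ,
    cov[X i j, X i' j'; P] = r ((i : ℤ) - (i' : ℤ)) * s ((j : ℤ) - (j' : ℤ))

/-- The shifted Wishart matrix, with entries
`(1 / √d) * ∑_{k < d} (X i k * X j k - r (i - j))` for `i, j < n`. -/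
def shiftedWishart {Ω : Type*} (r : ℤ → ℝ) (X : ℕ → ℕ → Ω → ℝ) (n d : ℕ) (ω : Ω) :
    Matrix (Fin n) (Fin n) ℝ :=
  Matrix.of fun i j =>
    (1 / Real.sqrt d) *
      ∑ k ∈ Finset.range d, (X i k ω * X j k ω - r (((i : ℕ) : ℤ) - ((j : ℕ) : ℤ)))

/-- `G` is a centered Gaussian random symmetric matrix whose entries have the same covariances
as the entries of the random matrix `W`. The two may live on different probability spaces. -/
structure IsGaussianCounterpart {Ω Ω' : Type*} [MeasurableSpace Ω] [MeasurableSpace Ω'] {n : ℕ}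
    (W : Ω → Matrix (Fin n) (Fin n) ℝ) (P : Measure Ω)
    (G : Ω' → Matrix (Fin n) (Fin n) ℝ) (P' : Measure Ω') : Prop where
  symm : ∀ ω, (G ω).IsSymm
  gaussian : HasGaussianLaw (fun ω (p : Fin n × Fin n) => G ω p.1 p.2) P'
  centered : ∀ i j, ∫ ω, G ω i j ∂P' = 0
  cov_eq : ∀ i j u v,
    cov[fun ω => G ω i j, fun ω => G ω u v; P'] = cov[fun ω => W ω i j, fun ω => W ω u v; P]

/-- The positions `(i, j)` with `i ≤ j` of an `n × n` matrix; there are `n (n + 1) / 2`. -/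
abbrev HalfIndex (n : ℕ) : Type := {p : Fin n × Fin n // p.1 ≤ p.2}

/-- The random vector of the upper-triangular entries (diagonal included) of a random matrix. -/
def half {Ω : Type*} {n : ℕ} (M : Ω → Matrix (Fin n) (Fin n) ℝ) (ω : Ω) :
    EuclideanSpace ℝ (HalfIndex n) :=
  WithLp.toLp 2 fun p => M ω p.1.1 p.1.2

/-- `‖h''‖_∞`: the supremum over `x, i, j` of `|∂²h / ∂x_i ∂x_j (x)|` (for `h` of class `C²`). -/
def hessEntrySup {ι : Type*} [Fintype ι] (h : EuclideanSpace ℝ ι → ℝ) : ℝ≥0∞ :=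
  ⨆ (x : EuclideanSpace ℝ ι) (i : ι) (j : ι),
    ‖fderiv ℝ (fderiv ℝ h) x (EuclideanSpace.basisFun ι ℝ i) (EuclideanSpace.basisFun ι ℝ j)‖ₑ

/-- `M₂(h)`: the supremum over `x` of the operator norm of the Hessian of `h` at `x`
(for `h` of class `C²`), with respect to the Euclidean norm. -/
def hessOpSup {ι : Type*} [Fintype ι] (h : EuclideanSpace ℝ ι → ℝ) : ℝ≥0∞ :=
  ⨆ x : EuclideanSpace ℝ ι, ‖fderiv ℝ (fderiv ℝ h) x‖ₑ

/-- `d₂(X, Y) = sup |E[h(X)] - E[h(Y)]|` over the `C²` functions `h` with `‖h''‖_∞ ≤ 1`, for random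
vectors `X, Y` with square-integrable components (`h` then has at most quadratic growth, so that
`h(X)` and `h(Y)` are integrable). -/
def dist₂ {Ω Ω' ι : Type*} [MeasurableSpace Ω] [MeasurableSpace Ω'] [Fintype ι]
    (X : Ω → EuclideanSpace ℝ ι) (P : Measure Ω)
    (Y : Ω' → EuclideanSpace ℝ ι) (P' : Measure Ω') : ℝ≥0∞ :=
  ⨆ (h : EuclideanSpace ℝ ι → ℝ) (_ : ContDiff ℝ 2 h) (_ : hessEntrySup h ≤ 1),
    ENNReal.ofReal |(∫ ω, h (X ω) ∂P) - ∫ ω, h (Y ω) ∂P'|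

/-- `d̃₂(X, Y) = sup |E[h(X)] - E[h(Y)]|` over the `C²` functions `h` with `M₂(h) ≤ 1`, for random
vectors `X, Y` with square-integrable components. -/
def distTilde₂ {Ω Ω' ι : Type*} [MeasurableSpace Ω] [MeasurableSpace Ω'] [Fintype ι]
    (X : Ω → EuclideanSpace ℝ ι) (P : Measure Ω)
    (Y : Ω' → EuclideanSpace ℝ ι) (P' : Measure Ω') : ℝ≥0∞ :=
  ⨆ (h : EuclideanSpace ℝ ι → ℝ) (_ : ContDiff ℝ 2 h) (_ : hessOpSup h ≤ 1),
    ENNReal.ofReal |(∫ ω, h (X ω) ∂P) - ∫ ω, h (Y ω) ∂P'|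

/-- The rate `n ^ a / √d * (∑_{|k| ≤ d} |s k| ^ (4/3)) ^ (3/2)`. -/
def rate (a : ℝ) (s : ℤ → ℝ) (n d : ℕ) : ℝ :=
  (n : ℝ) ^ a / Real.sqrt d *
    (∑ k ∈ Finset.Icc (-(d : ℤ)) (d : ℤ), |s k| ^ (4 / 3 : ℝ)) ^ (3 / 2 : ℝ)

end WishartOverall

end

open WishartOverall

open MeasureTheory ProbabilityTheory
open scoped ENNReal NNReal

/-! The argument is Stein's method with an explicit kernel. If `F` has Stein kernel `τ` and `Z` has
constant kernel `C`, then differentiating `E h(sin θ F + cos θ Z)`, with `F` and `Z` independent,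
and integrating by parts in each leaves `sin θ cos θ E ∑ (τ - C)_{ab} ∂_a ∂_b h`. So only the
fluctuations of `τ` matter (`IsSteinKernel.abs_integral_sub_le`); no inverse covariance or smoothing
is needed, so the laws may be degenerate.

An entry of the Wishart matrix is a sum of centered products `X_{ik} X_{jk}`. Gaussian integration
by parts in the first factor alone already yields a Stein kernel (`isSteinKernel_quadVector`). For
entries `a = (i, j)` and `b = (u, v)` it is `1/d ∑_{k,l} s(k-l) X_{jk} (r(i-u) X_{vl} + r(i-v)
X_{ul})`. Its mean is the common covariance of both half vectors, and its fluctuation is `1/d` times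
a combination of two centered forms (`crossForm`) with the explicit coefficients `r(i-u)` and
`r(i-v)`.

By Isserlis' formula the second moment of a `crossForm` is at most two sums over closed walks of
length four of products of `|s|`. The arithmetic-geometric inequality bounds each by `d S_d ^ 3`
(`sum_cycle_le`). Hence the variance of `τ_{ab}` is at most `4 S_d ^ 3 / d * (r(i-u)^2 + r(i-v)^2)`.

It remains to add up standard deviations: over all pairs for `d₂`, and as Euclidean column norms for
`d̃₂`. The sum over `i` brings in row sums `R₁` of `|r|` and `R₂` of `r²`, the other indices are
free, and the totals are of order `n ^ 3 R₁` and `n ^ (5/2) √R₂`. The three assertions are three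
ways of bounding `R₁` and `R₂`. -/

/-! ### Gaussian integration by parts -/

lemma hasDerivAt_gaussianPDFReal_zero (v : ℝ≥0) (x : ℝ) :
    HasDerivAt (gaussianPDFReal 0 v) (-(x / v) * gaussianPDFReal 0 v x) x := by
  have h1 : HasDerivAt (fun y : ℝ => -(y - 0) ^ 2 / (2 * v)) (-(x / v)) x := by
    refine ((((hasDerivAt_id x).sub_const 0).fun_pow 2).fun_neg.div_const
      (2 * (v : ℝ))).congr_deriv ?_
    rcases eq_or_ne (v : ℝ) 0 with h | h
    · simp [h]
    · simp; field_simp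
  simp only [gaussianPDFReal_def]
  exact ((h1.exp).const_mul ((√(2 * Real.pi * v))⁻¹)).congr_deriv (by ring)

/-- Integration by parts with respect to a nondegenerate centered Gaussian measure on `ℝ`. -/
lemma integral_id_mul_gaussianReal {v : ℝ≥0} (hv : v ≠ 0) {f f' : ℝ → ℝ}
    (hf : ∀ x, HasDerivAt f (f' x) x) (h0 : Integrable f (gaussianReal 0 v))
    (h1 : Integrable f' (gaussianReal 0 v)) (h2 : Integrable (fun x => x * f x) (gaussianReal 0 v)) :
    ∫ x, x * f x ∂gaussianReal 0 v = v * ∫ x, f' x ∂gaussianReal 0 v := by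
  have hv' : (v : ℝ) ≠ 0 := by exact_mod_cast hv
  have key : ∀ g : ℝ → ℝ, Integrable g (gaussianReal 0 v) →
      Integrable (fun x => gaussianPDFReal 0 v x * g x) := by
    intro g hg
    rw [gaussianReal_of_var_ne_zero _ hv,
      integrable_withDensity_iff_integrable_smul' (measurable_gaussianPDF _ _)
        (ae_of_all _ fun _ => gaussianPDF_lt_top)] at hg
    simpa [toReal_gaussianPDF] using hg
  have := integral_mul_deriv_eq_deriv_mul_of_integrable (u := gaussianPDFReal 0 v)
    (u' := fun x => -(x / v) * gaussianPDFReal 0 v x) (v := f) (v' := f')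
    (fun x _ => hasDerivAt_gaussianPDFReal_zero v x) (fun x _ => hf x) (key _ h1)
    (by
      refine ((key _ h2).const_mul (-(v : ℝ)⁻¹)).congr (ae_of_all _ fun x => ?_)
      simp only [Pi.mul_apply]; field_simp)
    (key _ h0)
  rw [integral_gaussianReal_eq_integral_smul hv, integral_gaussianReal_eq_integral_smul hv]
  simp only [smul_eq_mul]
  rw [this, mul_neg, ← integral_const_mul, ← integral_neg]
  refine integral_congr_ae (ae_of_all _ fun x => ?_)
  simp only
  field_simp

/-- Gaussian integration by parts (Stein's identity), possibly degenerate. -/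
theorem ProbabilityTheory.HasGaussianLaw.integral_dual_mul {Ω E : Type*} [MeasurableSpace Ω]
    {P : Measure Ω} [NormedAddCommGroup E] [NormedSpace ℝ E] [MeasurableSpace E] [BorelSpace E]
    [CompleteSpace E] [SecondCountableTopology E] {X : Ω → E} (hX : HasGaussianLaw X P)
    {L : StrongDual ℝ E} (hL : ∫ ω, L (X ω) ∂P = 0) {c : E}
    (hc : ∀ M : StrongDual ℝ E, cov[fun ω => L (X ω), fun ω => M (X ω); P] = M c)
    {f : E → ℝ} (hf : ContDiff ℝ 1 f) (h0 : Integrable (fun ω => f (X ω)) P)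
    (h1 : Integrable (fun ω => fderiv ℝ f (X ω) c) P)
    (h2 : Integrable (fun ω => L (X ω) * f (X ω)) P) :
    ∫ ω, L (X ω) * f (X ω) ∂P = ∫ ω, fderiv ℝ f (X ω) c ∂P := by
  have hP := hX.isProbabilityMeasure
  have hLX : HasGaussianLaw (fun ω => L (X ω)) P := hX.map_fun L
  have hvar : Var[fun ω => L (X ω); P] = L c := by
    rw [← covariance_self hLX.aemeasurable]; exact hc L
  have hv0 : 0 ≤ L c := hvar ▸ variance_nonneg _ _
  have hlaw : P.map (fun ω => L (X ω)) = gaussianReal 0 (L c).toNNReal := by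
    rw [hLX.map_eq_gaussianReal, hL, hvar]
  -- If the variance vanishes, then `L(X) = 0` almost surely, so all covariances with it vanish and
  -- `c = 0` by duality.
  rcases hv0.eq_or_lt with hv | hv
  · have hz : (fun ω => L (X ω)) =ᵐ[P] 0 := by
      have := (evariance_eq_zero_iff (μ := P) hLX.aemeasurable).1 (by
        rw [← hLX.memLp_two.ofReal_variance_eq, hvar, ← hv]; simp)
      filter_upwards [this] with ω hω
      simpa [hL] using hω
    have hc0 : c = 0 := by
      refine SeparatingDual.eq_zero_of_forall_dual_eq_zero (R := ℝ) fun M => ?_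
      rw [← hc M, covariance, hL]
      refine integral_eq_zero_of_ae ?_
      filter_upwards [hz] with ω hω
      simp only [Pi.zero_apply] at hω
      simp [hω]
    rw [hc0]
    simp only [map_zero, integral_zero]
    refine integral_eq_zero_of_ae ?_
    filter_upwards [hz] with ω hω
    simp only [Pi.zero_apply] at hω
    simp [hω]
  set v := L c with hvdef
  have hvne : v ≠ 0 := hv.ne'
  -- `T` removes the component correlated with `L(X)`. Joint Gaussianity makes `T(X)` independent of
  -- `L(X)`, and `X = T(X) + v⁻¹ L(X) c` then allows the one-dimensional formula with `T(X)` frozen.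
  let T : E →L[ℝ] E := ContinuousLinearMap.id ℝ E - (v⁻¹ • L).smulRight c
  have hT : ∀ x, T x = x - (v⁻¹ * L x) • c := fun x => by simp [T]
  let U : Ω → ℝ := fun ω => L (X ω)
  let Y : Ω → E := fun ω => T (X ω)
  have hUY : HasGaussianLaw (fun ω => (U ω, Y ω)) P := hX.map_fun (L.prod T)
  have hind : IndepFun U Y P := by
    refine hUY.indepFun_of_covariance_strongDual fun L₁ L₂ => ?_
    have e1 : L₁ ∘ U = fun ω => L₁ 1 * U ω := by
      ext ω
      have : L₁ (U ω • (1 : ℝ)) = U ω • L₁ 1 := map_smul _ _ _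
      simpa [mul_comm] using this
    have e2 : L₂ ∘ Y = fun ω => (L₂ ∘L T) (X ω) := rfl
    rw [e1, e2, covariance_const_mul_left, hc]
    simp [hT, ← hvdef, hvne]
  have hmeas : AEMeasurable (fun ω => (U ω, Y ω)) P := hUY.aemeasurable
  have hmap : P.map (fun ω => (U ω, Y ω)) = (gaussianReal 0 v.toNNReal).prod (P.map Y) := by
    rw [(indepFun_iff_map_prod_eq_prod_map_map hUY.fst.aemeasurable hUY.snd.aemeasurable).1 hind,
      hlaw]
  have : IsProbabilityMeasure (P.map Y) := Measure.isProbabilityMeasure_map hUY.snd.aemeasurable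
  let R : ℝ × E → E := fun z => z.2 + (v⁻¹ * z.1) • c
  have hR : ∀ ω, R (U ω, Y ω) = X ω := fun ω => by simp [R, U, Y, hT]
  have hRc : Continuous R := by fun_prop
  have hfc : Continuous f := hf.continuous
  have hfd : Continuous fun x => fderiv ℝ f x c :=
    (hf.continuous_fderiv one_ne_zero).clm_apply continuous_const
  have tr : ∀ φ : ℝ × E → ℝ, Continuous φ → Integrable (fun ω => φ (U ω, Y ω)) P →
      Integrable φ ((gaussianReal 0 v.toNNReal).prod (P.map Y)) ∧
      ∫ ω, φ (U ω, Y ω) ∂P = ∫ y, ∫ u, φ (u, y) ∂gaussianReal 0 v.toNNReal ∂P.map Y := by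
    intro φ hφ hi
    have hi' : Integrable φ ((gaussianReal 0 v.toNNReal).prod (P.map Y)) := by
      rw [← hmap]
      exact (integrable_map_measure hφ.aestronglyMeasurable hmeas).2 hi
    refine ⟨hi', ?_⟩
    rw [← integral_prod_symm _ hi', ← hmap, integral_map hmeas hφ.aestronglyMeasurable]
  obtain ⟨i0, -⟩ := tr (fun z => f (R z)) (by fun_prop) (by simpa only [hR] using h0)
  obtain ⟨i1, e1⟩ := tr (fun z => fderiv ℝ f (R z) c) (hfd.comp hRc) (by simpa only [hR] using h1)
  obtain ⟨i2, e2⟩ := tr (fun z => z.1 * f (R z)) (by fun_prop) (by simpa only [hR] using h2)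
  simp only [hR] at e1 e2
  rw [e1, e2]
  refine integral_congr_ae ?_
  filter_upwards [i0.prod_left_ae, i1.prod_left_ae, i2.prod_left_ae] with y j0 j1 j2
  have hd : ∀ u, HasDerivAt (fun u => f (R (u, y))) (v⁻¹ * fderiv ℝ f (R (u, y)) c) u := by
    intro u
    have hr : HasDerivAt (fun u : ℝ => R (u, y)) (v⁻¹ • c) u := by
      have := (((hasDerivAt_id u).const_mul v⁻¹).smul_const c).const_add y
      simpa [R] using this
    exact (((hf.differentiable one_ne_zero (R (u, y))).hasFDerivAt).comp_hasDerivAt u hr).congr_deriv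
      (by simp)
  rw [integral_id_mul_gaussianReal (by simpa using hv) hd j0 (j1.const_mul _) j2,
    integral_const_mul, Real.coe_toNNReal _ hv.le, ← mul_assoc, mul_inv_cancel₀ hvne, one_mul]

/-! ### Stein kernels and interpolation -/

section SteinKernel

variable {Ω Ω' ι : Type*} [MeasurableSpace Ω] [MeasurableSpace Ω'] [Fintype ι]

/-- `τ` is a Stein kernel of the random vector `F`:
`E[F_a g(F)] = ∑_b E[τ_ab ∂_b g(F)]` for all `C¹` functions `g` with bounded derivative. -/
def IsSteinKernel (F : Ω → EuclideanSpace ℝ ι) (τ : ι → ι → Ω → ℝ) (P : Measure Ω) : Prop :=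
  ∀ (a : ι) (g : EuclideanSpace ℝ ι → ℝ), ContDiff ℝ 1 g → (∃ K, ∀ x, ‖fderiv ℝ g x‖ ≤ K) →
    ∫ ω, F ω a * g (F ω) ∂P =
      ∫ ω, ∑ b, τ a b ω * fderiv ℝ g (F ω) (EuclideanSpace.basisFun ι ℝ b) ∂P

/-- This is the form used along the interpolation, with the other random vector frozen in `u`; the
chain rule contributes the factor `t`. -/
lemma IsSteinKernel.integral_affine {F : Ω → EuclideanSpace ℝ ι} {τ : ι → ι → Ω → ℝ}
    {P : Measure Ω} (hF : IsSteinKernel F τ P) (a : ι) {g : EuclideanSpace ℝ ι → ℝ}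
    (hg : ContDiff ℝ 1 g) {K : ℝ} (hK : ∀ x, ‖fderiv ℝ g x‖ ≤ K) (t : ℝ)
    (u : EuclideanSpace ℝ ι) :
    ∫ ω, F ω a * g (t • F ω + u) ∂P =
      ∫ ω, ∑ b, t * (τ a b ω *
        fderiv ℝ g (t • F ω + u) (EuclideanSpace.basisFun ι ℝ b)) ∂P := by
  have hd : ∀ x, HasFDerivAt (fun x => g (t • x + u)) (t • fderiv ℝ g (t • x + u)) x := by
    intro x
    have h1 : HasFDerivAt (fun x : EuclideanSpace ℝ ι => t • x + u)
        (t • ContinuousLinearMap.id ℝ (EuclideanSpace ℝ ι)) x :=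
      ((hasFDerivAt_id x).const_smul t).add_const u
    refine (((hg.differentiable one_ne_zero) (t • x + u)).hasFDerivAt.comp x h1).congr_fderiv ?_
    ext v; simp
  rw [hF a (fun x => g (t • x + u)) (by fun_prop) ⟨|t| * K, fun x => ?_⟩]
  · refine integral_congr_ae (ae_of_all _ fun ω => Finset.sum_congr rfl fun b _ => ?_)
    rw [(hd _).fderiv]
    simp only [FunLike.coe_smul, Pi.smul_apply, smul_eq_mul]
    ring
  · rw [(hd x).fderiv, norm_smul]
    exact mul_le_mul_of_nonneg_left (hK _) (abs_nonneg _)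

lemma norm_le_of_norm_fderiv_le {E G : Type*} [NormedAddCommGroup E] [NormedSpace ℝ E]
    [NormedAddCommGroup G] [NormedSpace ℝ G] {f : E → G} (hf : Differentiable ℝ f) {K : ℝ} {x : E}
    (hK : ∀ y, ‖y‖ ≤ ‖x‖ → ‖fderiv ℝ f y‖ ≤ K) : ‖f x‖ ≤ ‖f 0‖ + K * ‖x‖ := by
  have := (convex_closedBall (0 : E) ‖x‖).norm_image_sub_le_of_norm_fderiv_le (f := f) (x := 0)
    (y := x) (fun y _ => hf y) (fun y hy => hK y (by simpa using hy)) (by simp) (by simp)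
  rw [sub_zero] at this
  have h2 := norm_sub_norm_le (f x) (f 0)
  linarith

lemma norm_fderiv_le_of_norm_fderiv_fderiv_le {E : Type*} [NormedAddCommGroup E] [NormedSpace ℝ E]
    {h : E → ℝ} (hh : ContDiff ℝ 2 h) {K : ℝ} (hK : ∀ x, ‖fderiv ℝ (fderiv ℝ h) x‖ ≤ K) (x : E) :
    ‖fderiv ℝ h x‖ ≤ ‖fderiv ℝ h 0‖ + K * ‖x‖ :=
  norm_le_of_norm_fderiv_le ((hh.fderiv_right (m := 1) (by norm_num)).differentiable one_ne_zero)
    fun y _ => hK y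

lemma norm_le_of_norm_fderiv_fderiv_le {E : Type*} [NormedAddCommGroup E] [NormedSpace ℝ E]
    {h : E → ℝ} (hh : ContDiff ℝ 2 h) {K : ℝ} (hK : ∀ x, ‖fderiv ℝ (fderiv ℝ h) x‖ ≤ K) (x : E) :
    ‖h x‖ ≤ ‖h 0‖ + (‖fderiv ℝ h 0‖ + K * ‖x‖) * ‖x‖ := by
  have hK0 : 0 ≤ K := le_trans (norm_nonneg (fderiv ℝ (fderiv ℝ h) 0)) (hK 0)
  refine norm_le_of_norm_fderiv_le (hh.differentiable two_ne_zero) fun y hy =>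
    (norm_fderiv_le_of_norm_fderiv_fderiv_le hh hK y).trans ?_
  gcongr

set_option maxHeartbeats 400000 in
/-- Comparison of a random vector having a Stein kernel with one having a constant Stein kernel,
by interpolation along `sin θ • F + cos θ • Z`. -/
theorem IsSteinKernel.abs_integral_sub_le {P : Measure Ω} [IsProbabilityMeasure P]
    {P' : Measure Ω'} [IsProbabilityMeasure P'] {F : Ω → EuclideanSpace ℝ ι}
    {Z : Ω' → EuclideanSpace ℝ ι} {τ : ι → ι → Ω → ℝ} {C : ι → ι → ℝ}
    (hFk : IsSteinKernel F τ P) (hZk : IsSteinKernel Z (fun a b _ => C a b) P')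
    (hF : MemLp F 2 P) (hZ : MemLp Z 2 P') (hτ : ∀ a b, Integrable (τ a b) P)
    {h : EuclideanSpace ℝ ι → ℝ} (hh : ContDiff ℝ 2 h) {K : ℝ}
    (hK : ∀ x, ‖fderiv ℝ (fderiv ℝ h) x‖ ≤ K) {D : Ω → ℝ} (hD : Integrable D P)
    (hb : ∀ ω x, |∑ a, ∑ b, (τ a b ω - C a b) * fderiv ℝ (fderiv ℝ h) x
      (EuclideanSpace.basisFun ι ℝ b) (EuclideanSpace.basisFun ι ℝ a)| ≤ D ω) :
    |(∫ ω, h (F ω) ∂P) - ∫ ω, h (Z ω) ∂P'| ≤ Real.pi / 2 * ∫ ω, D ω ∂P := by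
  have hK0 : 0 ≤ K := le_trans (norm_nonneg (fderiv ℝ (fderiv ℝ h) 0)) (hK 0)
  set A : ℝ := ‖fderiv ℝ h 0‖ with hA
  have hA0 : 0 ≤ A := norm_nonneg _
  set e : ι → EuclideanSpace ℝ ι := fun b => EuclideanSpace.basisFun ι ℝ b with he
  have hen : ∀ b, ‖e b‖ = 1 := fun b => (EuclideanSpace.basisFun ι ℝ).orthonormal.1 b
  let μ := P.prod P'
  -- The product space supplies independent copies. `V` is the derivative of the path `W`, and `N`
  -- dominates both uniformly in `θ`.
  let W : ℝ → Ω × Ω' → EuclideanSpace ℝ ι := fun θ z => Real.sin θ • F z.1 + Real.cos θ • Z z.2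
  let V : ℝ → Ω × Ω' → EuclideanSpace ℝ ι := fun θ z => Real.cos θ • F z.1 - Real.sin θ • Z z.2
  let N : Ω × Ω' → ℝ := fun z => ‖F z.1‖ + ‖Z z.2‖
  have hF' : MemLp (fun z : Ω × Ω' => F z.1) 2 μ := hF.comp_fst P'
  have hZ' : MemLp (fun z : Ω × Ω' => Z z.2) 2 μ := hZ.comp_snd P
  have hN2 : MemLp N 2 μ := hF'.norm.add hZ'.norm
  have hN1 : Integrable N μ := hN2.integrable (by norm_num)
  have hNN : Integrable (fun z => N z * N z) μ := hN2.integrable_mul hN2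
  have hN0 : ∀ z, 0 ≤ N z := fun z => by positivity
  have hWm : ∀ θ, AEStronglyMeasurable (W θ) μ := fun θ =>
    (hF'.1.const_smul (Real.sin θ)).add (hZ'.1.const_smul (Real.cos θ))
  have hVm : ∀ θ, AEStronglyMeasurable (V θ) μ := fun θ =>
    (hF'.1.const_smul (Real.cos θ)).sub (hZ'.1.const_smul (Real.sin θ))
  have hWN : ∀ θ z, ‖W θ z‖ ≤ N z := fun θ z => by
    refine (norm_add_le (Real.sin θ • F z.1) (Real.cos θ • Z z.2)).trans ?_
    rw [norm_smul, norm_smul]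
    exact add_le_add (mul_le_of_le_one_left (norm_nonneg _) (Real.abs_sin_le_one _))
      (mul_le_of_le_one_left (norm_nonneg _) (Real.abs_cos_le_one _))
  have hVN : ∀ θ z, ‖V θ z‖ ≤ N z := fun θ z => by
    refine (norm_sub_le (Real.cos θ • F z.1) (Real.sin θ • Z z.2)).trans ?_
    rw [norm_smul, norm_smul]
    exact add_le_add (mul_le_of_le_one_left (norm_nonneg _) (Real.abs_cos_le_one _))
      (mul_le_of_le_one_left (norm_nonneg _) (Real.abs_sin_le_one _))
  have hDh : ∀ θ z, ‖fderiv ℝ h (W θ z)‖ ≤ A + K * N z := fun θ z =>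
    (norm_fderiv_le_of_norm_fderiv_fderiv_le hh hK _).trans (by gcongr; exact hWN θ z)
  have hc1 : Continuous (fderiv ℝ h) := hh.continuous_fderiv two_ne_zero
  have hcd : ContDiff ℝ 1 (fderiv ℝ h) := hh.fderiv_right (by norm_num)
  have hc2 : Continuous (fderiv ℝ (fderiv ℝ h)) := hcd.continuous_fderiv one_ne_zero
  have hbound : Integrable (fun z => (A + K * N z) * N z) μ := by
    refine ((hN1.const_mul A).add (hNN.const_mul K)).congr (ae_of_all _ fun z => ?_)
    simp only [Pi.add_apply]; ring
  have hint : ∀ θ, Integrable (fun z => h (W θ z)) μ := fun θ => by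
    refine ((integrable_const ‖h 0‖).add hbound).mono'
      (hh.continuous.comp_aestronglyMeasurable (hWm θ)) (ae_of_all _ fun z => ?_)
    refine (norm_le_of_norm_fderiv_fderiv_le hh hK _).trans ?_
    simp only [Pi.add_apply]
    gcongr <;> exact hWN θ z
  let Ψ' : ℝ → ℝ := fun θ => ∫ z, fderiv ℝ h (W θ z) (V θ z) ∂μ
  have hder : ∀ θ, HasDerivAt (fun θ => ∫ z, h (W θ z) ∂μ) (Ψ' θ) θ := fun θ => by
    refine (hasDerivAt_integral_of_dominated_loc_of_deriv_le (F := fun θ z => h (W θ z))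
      (F' := fun θ z => fderiv ℝ h (W θ z) (V θ z)) (bound := fun z => (A + K * N z) * N z)
      (s := Set.univ) Filter.univ_mem
      (Filter.Eventually.of_forall fun θ => (hint θ).1) (hint θ) ?_ ?_ hbound ?_).2
    · exact ((hc1.comp continuous_fst).clm_apply continuous_snd).comp_aestronglyMeasurable
        ((hWm θ).prodMk (hVm θ))
    · refine ae_of_all _ fun z θ _ => (ContinuousLinearMap.le_opNorm _ _).trans ?_
      have := hN0 z
      exact mul_le_mul (hDh θ z) (hVN θ z) (norm_nonneg _) (by positivity)
    · refine ae_of_all _ fun z θ _ => ?_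
      have hw : HasDerivAt (fun θ => W θ z) (V θ z) θ := by
        refine (((Real.hasDerivAt_sin θ).smul_const (F z.1)).add
          ((Real.hasDerivAt_cos θ).smul_const (Z z.2))).congr_deriv ?_
        simp only [V, neg_smul, sub_eq_add_neg]
      exact (hh.differentiable two_ne_zero (W θ z)).hasFDerivAt.comp_hasDerivAt θ hw
  let H : ℝ → ι → ι → Ω × Ω' → ℝ := fun θ a b z => fderiv ℝ (fderiv ℝ h) (W θ z) (e b) (e a)
  have hHm : ∀ θ a b, AEStronglyMeasurable (H θ a b) μ := fun θ a b =>
    ((hc2.clm_apply continuous_const).clm_apply continuous_const).comp_aestronglyMeasurable (hWm θ)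
  have hHb : ∀ θ a b z, ‖H θ a b z‖ ≤ K := fun θ a b z => by
    refine (ContinuousLinearMap.le_opNorm₂ _ _ _).trans ?_
    rw [hen, hen, mul_one, mul_one]
    exact hK _
  let g : ι → EuclideanSpace ℝ ι → ℝ := fun a x => fderiv ℝ h x (e a)
  have hgc : ∀ a, ContDiff ℝ 1 (g a) := fun a => hcd.clm_apply contDiff_const
  have hgd : ∀ a x v, fderiv ℝ (g a) x v = fderiv ℝ (fderiv ℝ h) x v (e a) := fun a x v => by
    have := ((hcd.differentiable one_ne_zero x).hasFDerivAt.clm_apply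
      (hasFDerivAt_const (e a) x)).fderiv
    simp only [g]
    rw [this]
    simp
  have hgK : ∀ a x, ‖fderiv ℝ (g a) x‖ ≤ K := fun a x => by
    refine ContinuousLinearMap.opNorm_le_bound _ hK0 fun v => ?_
    rw [hgd]
    refine (ContinuousLinearMap.le_opNorm₂ _ _ _).trans ?_
    rw [hen, mul_one]
    gcongr
    exact hK _
  have hgW : ∀ a θ, AEStronglyMeasurable (fun z => g a (W θ z)) μ := fun a θ =>
    (hgc a).continuous.comp_aestronglyMeasurable (hWm θ)
  have hgN : ∀ a θ z, ‖g a (W θ z)‖ ≤ A + K * N z := fun a θ z => by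
    refine (ContinuousLinearMap.le_opNorm _ _).trans ?_
    rw [hen, mul_one]
    exact hDh θ z
  have hcoord : ∀ a, Continuous fun x : EuclideanSpace ℝ ι => x a := fun a => by fun_prop
  have hmulint : ∀ a θ (f : Ω × Ω' → ℝ), AEStronglyMeasurable f μ → (∀ z, ‖f z‖ ≤ N z) →
      Integrable (fun z => f z * g a (W θ z)) μ := fun a θ f hf hfN => by
    refine hbound.mono' (hf.mul (hgW a θ)) (ae_of_all _ fun z => ?_)
    rw [norm_mul, mul_comm]
    have := hN0 z
    exact mul_le_mul (hgN a θ z) (hfN z) (norm_nonneg _) (by positivity)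
  have hFg : ∀ a θ, Integrable (fun z => F z.1 a * g a (W θ z)) μ := fun a θ =>
    hmulint a θ _ ((hcoord a).comp_aestronglyMeasurable hF'.1) fun z =>
      (PiLp.norm_apply_le (F z.1) a).trans (le_add_of_nonneg_right (norm_nonneg _))
  have hZg : ∀ a θ, Integrable (fun z => Z z.2 a * g a (W θ z)) μ := fun a θ =>
    hmulint a θ _ ((hcoord a).comp_aestronglyMeasurable hZ'.1) fun z =>
      (PiLp.norm_apply_le (Z z.2) a).trans (le_add_of_nonneg_left (norm_nonneg _))
  have hτH : ∀ a b θ, Integrable (fun z => τ a b z.1 * H θ a b z) μ := fun a b θ =>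
    ((hτ a b).comp_fst P').mul_bdd (hHm θ a b) (ae_of_all _ (hHb θ a b))
  have hCH : ∀ a b θ, Integrable (fun z => C a b * H θ a b z) μ := fun a b θ =>
    (integrable_const (C a b)).mul_bdd (hHm θ a b) (ae_of_all _ (hHb θ a b))
  have hFI : ∀ a θ, ∫ z, F z.1 a * g a (W θ z) ∂μ
      = ∫ z, ∑ b, Real.sin θ * (τ a b z.1 * H θ a b z) ∂μ := fun a θ => by
    rw [integral_prod_symm _ (hFg a θ), integral_prod_symm _
      (integrable_finsetSum _ fun b _ => (hτH a b θ).const_mul _)]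
    refine integral_congr_ae (ae_of_all _ fun ω' => ?_)
    refine (hFk.integral_affine a (hgc a) (hgK a) (Real.sin θ) (Real.cos θ • Z ω')).trans ?_
    simp only [hgd]
    rfl
  have hZI : ∀ a θ, ∫ z, Z z.2 a * g a (W θ z) ∂μ
      = ∫ z, ∑ b, Real.cos θ * (C a b * H θ a b z) ∂μ := fun a θ => by
    rw [integral_prod _ (hZg a θ), integral_prod _
      (integrable_finsetSum _ fun b _ => (hCH a b θ).const_mul _)]
    refine integral_congr_ae (ae_of_all _ fun ω => ?_)
    have := hZk.integral_affine a (hgc a) (hgK a) (Real.cos θ) (Real.sin θ • F ω)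
    simp only [hgd, add_comm _ (Real.sin θ • F ω)] at this
    exact this
  -- Integration by parts in `F` brings out `sin θ` and in `Z` brings out `cos θ`. With the factors
  -- already in `V`, both terms carry the same weight `sin θ cos θ`, so the kernels subtract.
  have hΨ : ∀ θ, Ψ' θ = Real.sin θ * Real.cos θ *
      ∫ z, ∑ a, ∑ b, (τ a b z.1 - C a b) * H θ a b z ∂μ := fun θ => by
    have e1 : ∀ z, fderiv ℝ h (W θ z) (V θ z)
        = ∑ a, (Real.cos θ * (F z.1 a * g a (W θ z)) - Real.sin θ * (Z z.2 a * g a (W θ z))) := by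
      intro z
      conv_lhs => rw [← (EuclideanSpace.basisFun ι ℝ).sum_repr (V θ z)]
      rw [map_sum]
      refine Finset.sum_congr rfl fun a _ => ?_
      rw [map_smul, smul_eq_mul]
      simp only [V, EuclideanSpace.basisFun_repr, PiLp.sub_apply, PiLp.smul_apply, smul_eq_mul]
      ring
    simp only [Ψ', e1]
    have hI1 : ∀ a, Integrable (fun z => Real.cos θ * (F z.1 a * g a (W θ z)) -
        Real.sin θ * (Z z.2 a * g a (W θ z))) μ := fun a =>
      ((hFg a θ).const_mul _).sub ((hZg a θ).const_mul _)
    have hI2 : ∀ a b, Integrable (fun z => (τ a b z.1 - C a b) * H θ a b z) μ := fun a b => by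
      simp only [sub_mul]
      exact (hτH a b θ).sub (hCH a b θ)
    rw [integral_finsetSum _ fun a _ => hI1 a,
      integral_finsetSum _ fun a _ => integrable_finsetSum _ fun b _ => hI2 a b, Finset.mul_sum]
    · refine Finset.sum_congr rfl fun a _ => ?_
      rw [integral_sub ((hFg a θ).const_mul _) ((hZg a θ).const_mul _), integral_const_mul,
        integral_const_mul, hFI, hZI, ← integral_const_mul, ← integral_const_mul,
        ← integral_const_mul, ← integral_sub]
      · refine integral_congr_ae (ae_of_all _ fun z => ?_)
        simp only [Finset.mul_sum, ← Finset.sum_sub_distrib]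
        exact Finset.sum_congr rfl fun b _ => by ring
      · exact (integrable_finsetSum _ fun b _ => (hτH a b θ).const_mul _).const_mul _
      · exact (integrable_finsetSum _ fun b _ => (hCH a b θ).const_mul _).const_mul _
  have hD' : ∫ z, D z.1 ∂μ = ∫ ω, D ω ∂P := by
    rw [integral_fun_fst]; simp
  have hDΨ : ∀ θ, ‖Ψ' θ‖ ≤ ∫ ω, D ω ∂P := fun θ => by
    have h1 : ‖∫ z, ∑ a, ∑ b, (τ a b z.1 - C a b) * H θ a b z ∂μ‖ ≤ ∫ z, D z.1 ∂μ :=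
      norm_integral_le_of_norm_le (hD.comp_fst P') (ae_of_all _ fun z => hb z.1 (W θ z))
    rw [hΨ, norm_mul, ← hD', norm_mul]
    refine (mul_le_of_le_one_left (norm_nonneg _) ?_).trans h1
    exact mul_le_one₀ (Real.abs_sin_le_one _) (norm_nonneg _) (Real.abs_cos_le_one _)
  -- The weight `sin θ cos θ` was bounded by `1`, so the length of `[0, π/2]` is the constant.
  have hfin := norm_image_sub_le_of_norm_deriv_le_segment' (a := 0) (b := Real.pi / 2)
    (fun θ _ => (hder θ).hasDerivWithinAt) (fun θ _ => hDΨ θ) (Real.pi / 2)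
    (Set.right_mem_Icc.2 (by positivity))
  have eF : ∫ z, h (W (Real.pi / 2) z) ∂μ = ∫ ω, h (F ω) ∂P := by
    simp only [W, Real.sin_pi_div_two, Real.cos_pi_div_two, one_smul, zero_smul, add_zero]
    exact (integral_fun_fst (μ := P) (ν := P') fun ω => h (F ω)).trans (by simp)
  have eZ : ∫ z, h (W 0 z) ∂μ = ∫ ω, h (Z ω) ∂P' := by
    simp only [W, Real.sin_zero, Real.cos_zero, one_smul, zero_smul, zero_add]
    exact (integral_fun_snd (μ := P) (ν := P') fun ω => h (Z ω)).trans (by simp)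
  simp only [eF, eZ, sub_zero] at hfin
  rw [mul_comm]
  exact hfin

end SteinKernel

/-! ### Moments of centered Gaussian families -/

section GaussianFamily

variable {Ω κ : Type*} [MeasurableSpace Ω] {P : Measure Ω} {X : κ → Ω → ℝ}

instance holderTriple_four_four_two : ENNReal.HolderTriple 4 4 2 where
  inv_add_inv_eq_inv := by
    rw [← two_mul, show (4 : ℝ≥0∞) = 2 * 2 by norm_num,
      ENNReal.mul_inv (by simp) (by simp), ← mul_assoc, ENNReal.mul_inv_cancel (by simp) (by simp),
      one_mul]

lemma memLp_two_mul_gaussian (hX : HasGaussianLaw (fun ω p => X p ω) P) (p q : κ) :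
    MemLp (fun ω => X p ω * X q ω) 2 P :=
  ((hX.eval q).memLp (p := 4) (by norm_num)).mul' ((hX.eval p).memLp (p := 4) (by norm_num))

lemma integral_mul_eq_covariance
    (h0 : ∀ p, ∫ ω, X p ω ∂P = 0) (p q : κ) : ∫ ω, X p ω * X q ω ∂P = cov[X p, X q; P] := by
  simp [covariance, h0]

variable [Fintype κ]

/-- Gaussian integration by parts for a centered Gaussian family. -/
lemma integral_mul_comp_gaussian (hX : HasGaussianLaw (fun ω p => X p ω) P)
    (h0 : ∀ p, ∫ ω, X p ω ∂P = 0) (p : κ) {f : (κ → ℝ) → ℝ} (hf : ContDiff ℝ 1 f)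
    (i0 : Integrable (fun ω => f fun q => X q ω) P)
    (i1 : Integrable (fun ω => fderiv ℝ f (fun q => X q ω) fun q => cov[X p, X q; P]) P)
    (i2 : Integrable (fun ω => X p ω * f fun q => X q ω) P) :
    ∫ ω, X p ω * f (fun q => X q ω) ∂P =
      ∫ ω, fderiv ℝ f (fun q => X q ω) (fun q => cov[X p, X q; P]) ∂P := by
  classical
  have := hX.isProbabilityMeasure
  refine hX.integral_dual_mul (L := ContinuousLinearMap.proj p) (h0 p) (fun M => ?_) hf i0 i1 i2
  have hM : ∀ x : κ → ℝ, M x = ∑ q, x q * M (Pi.single q 1) := fun x => by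
    conv_lhs => rw [← Finset.univ_sum_single x, map_sum]
    refine Finset.sum_congr rfl fun q _ => ?_
    rw [← smul_eq_mul, ← map_smul, ← Pi.single_smul]; simp
  have hMX : (fun ω => M fun q => X q ω) = fun ω => ∑ q, X q ω * M (Pi.single q 1) :=
    funext fun ω => hM _
  rw [hM, hMX, covariance_fun_sum_right]
  · simp only [covariance_mul_const_right, ContinuousLinearMap.proj_apply]
  · exact fun q => (hX.eval q).memLp_two.mul_const _
  · exact (hX.eval p).memLp_two

/-- Integrate by parts in `X p` against `x q * f x`: the term where the derivative falls on `x q` is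
cancelled by the centering. -/
lemma integral_sub_mul_comp_gaussian (hX : HasGaussianLaw (fun ω p => X p ω) P)
    (h0 : ∀ p, ∫ ω, X p ω ∂P = 0) (p q : κ) {f : (κ → ℝ) → ℝ} (hf : ContDiff ℝ 1 f)
    (i0 : MemLp (fun ω => f fun q => X q ω) 2 P)
    (i1 : MemLp (fun ω => fderiv ℝ f (fun q => X q ω) fun q => cov[X p, X q; P]) 2 P) :
    ∫ ω, (X p ω * X q ω - cov[X p, X q; P]) * f (fun q => X q ω) ∂P =
      ∫ ω, X q ω * fderiv ℝ f (fun q => X q ω) (fun q => cov[X p, X q; P]) ∂P := by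
  have := hX.isProbabilityMeasure
  have hd : ∀ x v, fderiv ℝ (fun x : κ → ℝ => x q * f x) x v = v q * f x + x q * fderiv ℝ f x v := by
    intro x v
    have h1 : HasFDerivAt (fun x : κ → ℝ => x q)
        (ContinuousLinearMap.proj (R := ℝ) (φ := fun _ : κ => ℝ) q) x :=
      (ContinuousLinearMap.proj (R := ℝ) (φ := fun _ : κ => ℝ) q).hasFDerivAt
    rw [(h1.fun_mul (hf.differentiable one_ne_zero x).hasFDerivAt).fderiv]
    simp; ring
  have hq2 := (hX.eval q).memLp_two
  have j1 : Integrable (fun ω => X q ω * fderiv ℝ f (fun q => X q ω)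
      fun q => cov[X p, X q; P]) P := hq2.integrable_mul i1
  have j0 := (i0.integrable (by norm_num)).const_mul cov[X p, X q; P]
  have j2 : Integrable (fun ω => X p ω * X q ω * f fun q => X q ω) P :=
    (memLp_two_mul_gaussian hX p q).integrable_mul i0
  have := integral_mul_comp_gaussian hX h0 p (f := fun x => x q * f x) (by fun_prop)
    (hq2.integrable_mul i0) (by simp only [hd]; exact j0.add j1)
    (by simpa only [mul_assoc] using j2)
  simp only [hd] at this
  rw [integral_add j0 j1] at this
  simp only [sub_mul, mul_assoc]
  rw [integral_sub (by simpa only [mul_assoc] using j2) j0, this]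
  simp

/-- The covariance of two products of centered jointly Gaussian variables (Isserlis). -/
lemma integral_sub_mul_mul_gaussian (hX : HasGaussianLaw (fun ω p => X p ω) P)
    (h0 : ∀ p, ∫ ω, X p ω ∂P = 0) (p q r s : κ) :
    ∫ ω, (X p ω * X q ω - cov[X p, X q; P]) * (X r ω * X s ω - cov[X r, X s; P]) ∂P =
      cov[X p, X r; P] * cov[X q, X s; P] + cov[X p, X s; P] * cov[X q, X r; P] := by
  have := hX.isProbabilityMeasure
  have hd : ∀ x v, fderiv ℝ (fun x : κ → ℝ => x r * x s - cov[X r, X s; P]) x v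
      = v r * x s + x r * v s := by
    intro x v
    have h1 : ∀ q, HasFDerivAt (fun x : κ → ℝ => x q)
        (ContinuousLinearMap.proj (R := ℝ) (φ := fun _ : κ => ℝ) q) x := fun q =>
      (ContinuousLinearMap.proj (R := ℝ) (φ := fun _ : κ => ℝ) q).hasFDerivAt
    rw [(((h1 r).fun_mul (h1 s)).sub_const _).fderiv]
    simp; ring
  have hm : ∀ q, MemLp (X q) 2 P := fun q => (hX.eval q).memLp_two
  have hi : ∀ q s, Integrable (fun ω => X q ω * X s ω) P := fun q s => (hm q).integrable_mul (hm s)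
  have := integral_sub_mul_comp_gaussian hX h0 p q
    (f := fun x => x r * x s - cov[X r, X s; P]) (by fun_prop)
    ((memLp_two_mul_gaussian hX r s).sub (memLp_const _))
    (by simp only [hd]; exact ((hm s).const_mul _).add ((hm r).mul_const _))
  rw [this]
  simp only [hd, mul_add]
  rw [integral_add]
  · simp only [mul_left_comm (X q _) (cov[X p, X r; P]), ← mul_assoc (X q _) (X r _)]
    rw [integral_const_mul, integral_mul_const, integral_mul_eq_covariance h0,
      integral_mul_eq_covariance h0]
    ring
  · simp only [mul_left_comm (X q _) (cov[X p, X r; P])]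
    exact (hi q s).const_mul _
  · simp only [← mul_assoc (X q _) (X r _)]
    exact (hi q r).mul_const _

end GaussianFamily

/-! ### Stein kernels of Gaussian vectors and of quadratic forms -/

section Kernels

variable {Ω ι : Type*} [MeasurableSpace Ω] [Fintype ι] {P : Measure Ω}

lemma isSteinKernel_covariance {Z : Ω → EuclideanSpace ℝ ι} (hZ : HasGaussianLaw Z P)
    (h0 : ∀ a, ∫ ω, Z ω a ∂P = 0) :
    IsSteinKernel Z (fun a b _ => cov[fun ω => Z ω a, fun ω => Z ω b; P]) P := by
  rintro a g hg ⟨K, hK⟩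
  have := hZ.isProbabilityMeasure
  have hK0 : 0 ≤ K := le_trans (norm_nonneg _) (hK 0)
  have hcoord : ∀ b, HasGaussianLaw (fun ω => Z ω b) P := fun b =>
    hZ.map_fun (EuclideanSpace.proj (𝕜 := ℝ) b)
  have hgm : MemLp (fun ω => g (Z ω)) 2 P := by
    refine ((memLp_const ‖g 0‖).add (hZ.memLp_two.norm.const_mul K)).mono'
      (hg.continuous.comp_aestronglyMeasurable hZ.memLp_two.1) (ae_of_all _ fun ω => ?_)
    exact norm_le_of_norm_fderiv_le (hg.differentiable one_ne_zero) fun y _ => hK y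
  let c : EuclideanSpace ℝ ι := WithLp.toLp 2 fun b => cov[fun ω => Z ω a, fun ω => Z ω b; P]
  have hsum : ∀ (M : StrongDual ℝ (EuclideanSpace ℝ ι)) (x : EuclideanSpace ℝ ι),
      M x = ∑ b, x b * M (EuclideanSpace.basisFun ι ℝ b) := fun M x => by
    conv_lhs => rw [← (EuclideanSpace.basisFun ι ℝ).sum_repr x]
    simp
  refine (hZ.integral_dual_mul (L := EuclideanSpace.proj (𝕜 := ℝ) a) (c := c) (h0 a) (fun M => ?_)
    hg (hgm.integrable (by norm_num)) ?_ ((hcoord a).memLp_two.integrable_mul hgm)).trans ?_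
  · have hMZ : (fun ω => M (Z ω)) = fun ω => ∑ b, Z ω b * M (EuclideanSpace.basisFun ι ℝ b) :=
      funext fun ω => hsum M _
    rw [hsum M c, hMZ]
    change cov[fun ω => Z ω a, _; P] = _
    rw [covariance_fun_sum_right]
    · simp only [covariance_mul_const_right]; rfl
    · exact fun b => (hcoord b).memLp_two.mul_const _
    · exact (hcoord a).memLp_two
  · refine (integrable_const (K * ‖c‖)).mono'
      (((hg.continuous_fderiv one_ne_zero).clm_apply
        continuous_const).comp_aestronglyMeasurable hZ.memLp_two.1) (ae_of_all _ fun ω => ?_)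
    exact (ContinuousLinearMap.le_opNorm _ _).trans (by gcongr; exact hK _)
  · refine integral_congr_ae (ae_of_all _ fun ω => ?_)
    exact hsum _ _

variable {κ ν : Type*} [Fintype ν]

/-- The vector of centered quadratic forms `w ∑_k (x_{p a k} x_{q a k} - m a k)`. -/
def quadVector (w : ℝ) (p q : ι → ν → κ) (m : ι → ν → ℝ) (x : κ → ℝ) : EuclideanSpace ℝ ι :=
  WithLp.toLp 2 fun a => w * ∑ k, (x (p a k) * x (q a k) - m a k)

variable {X : κ → Ω → ℝ}

lemma memLp_quadVector (hX : HasGaussianLaw (fun ω p => X p ω) P) (w : ℝ) (p q : ι → ν → κ)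
    (m : ι → ν → ℝ) : MemLp (fun ω => quadVector w p q m fun r => X r ω) 2 P := by
  have := hX.isProbabilityMeasure
  refine MemLp.of_eval_piLp fun a => ?_
  exact (memLp_finsetSum _ fun k _ =>
    (memLp_two_mul_gaussian hX _ _).sub (memLp_const _)).const_mul w

variable [Fintype κ]

lemma contDiff_quadVector (w : ℝ) (p q : ι → ν → κ) (m : ι → ν → ℝ) {n : ℕ∞} :
    ContDiff ℝ n (quadVector w p q m) := by
  unfold quadVector
  fun_prop

lemma fderiv_quadVector_apply (w : ℝ) (p q : ι → ν → κ) (m : ι → ν → ℝ) (x v : κ → ℝ) (a : ι) :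
    fderiv ℝ (quadVector w p q m) x v a =
      w * ∑ k, (v (p a k) * x (q a k) + x (p a k) * v (q a k)) := by
  have h1 := (EuclideanSpace.proj (𝕜 := ℝ) a : EuclideanSpace ℝ ι →L[ℝ] ℝ).hasFDerivAt.comp x
    (((contDiff_quadVector w p q m (n := 1)).differentiable one_ne_zero) x).hasFDerivAt
  have hp : ∀ r, HasFDerivAt (fun x : κ → ℝ => x r)
      (ContinuousLinearMap.proj (R := ℝ) (φ := fun _ : κ => ℝ) r) x := fun r =>
    (ContinuousLinearMap.proj (R := ℝ) (φ := fun _ : κ => ℝ) r).hasFDerivAt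
  have h2 := (HasFDerivAt.fun_sum (u := Finset.univ)
    fun k _ => ((hp (p a k)).fun_mul (hp (q a k))).sub_const (m a k)).const_mul w
  have h3 := congrArg (fun T => T v) (h1.unique h2)
  refine h3.trans ?_
  simp only [FunLike.coe_smul, Pi.smul_apply, smul_eq_mul, FunLike.coe_sum,
    Finset.sum_apply, FunLike.coe_add, Pi.add_apply, ContinuousLinearMap.proj_apply]
  congr 1
  exact Finset.sum_congr rfl fun k _ => by ring

/-- A Stein kernel of a vector of centered quadratic forms of a centered Gaussian family. -/
lemma isSteinKernel_quadVector (hX : HasGaussianLaw (fun ω p => X p ω) P)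
    (h0 : ∀ p, ∫ ω, X p ω ∂P = 0) (w : ℝ) (p q : ι → ν → κ) :
    IsSteinKernel
      (fun ω => quadVector w p q (fun a k => cov[X (p a k), X (q a k); P]) fun r => X r ω)
      (fun a b ω => w * ∑ k, X (q a k) ω * (w * ∑ l,
        (cov[X (p a k), X (p b l); P] * X (q b l) ω +
          X (p b l) ω * cov[X (p a k), X (q b l); P]))) P := by
  rintro a g hg ⟨K, hK⟩
  have := hX.isProbabilityMeasure
  set m : ι → ν → ℝ := fun a k => cov[X (p a k), X (q a k); P] with hm
  have hX2 : ∀ r, MemLp (X r) 2 P := fun r => (hX.eval r).memLp_two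
  have hF := memLp_quadVector hX w p q m
  have hgF : ContDiff ℝ 1 fun x => g (quadVector w p q m x) :=
    hg.comp (contDiff_quadVector w p q m (n := 1))
  have hgm : MemLp (fun ω => g (quadVector w p q m fun r => X r ω)) 2 P := by
    refine ((memLp_const ‖g 0‖).add (hF.norm.const_mul K)).mono'
      (hg.continuous.comp_aestronglyMeasurable hF.1) (ae_of_all _ fun ω => ?_)
    exact norm_le_of_norm_fderiv_le (hg.differentiable one_ne_zero) fun y _ => hK y
  -- The chain rule turns the derivative along the covariances of `X (p a k)` into a combination of
  -- the `∂_b g`, whose coefficients form the kernel.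
  have hd : ∀ x v, fderiv ℝ (fun x => g (quadVector w p q m x)) x v =
      ∑ b, (w * ∑ l, (v (p b l) * x (q b l) + x (p b l) * v (q b l))) *
        fderiv ℝ g (quadVector w p q m x) (EuclideanSpace.basisFun ι ℝ b) := fun x v => by
    have h1 := ((hg.differentiable one_ne_zero (quadVector w p q m x)).hasFDerivAt.comp x
      (((contDiff_quadVector w p q m (n := 1)).differentiable one_ne_zero) x).hasFDerivAt).fderiv
    refine (congrArg (fun T => T v) h1).trans ?_
    rw [ContinuousLinearMap.comp_apply]
    conv_lhs => rw [← (EuclideanSpace.basisFun ι ℝ).sum_repr (fderiv ℝ (quadVector w p q m) x v)]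
    simp [fderiv_quadVector_apply]
  have hDb : ∀ b, MemLp (fun ω => fderiv ℝ g (quadVector w p q m fun r => X r ω)
      (EuclideanSpace.basisFun ι ℝ b)) ∞ P := fun b => by
    refine memLp_top_of_bound (((hg.continuous_fderiv one_ne_zero).clm_apply
        continuous_const).comp_aestronglyMeasurable hF.1) K (ae_of_all _ fun ω => ?_)
    refine (ContinuousLinearMap.le_opNorm _ _).trans ?_
    rw [(EuclideanSpace.basisFun ι ℝ).orthonormal.1 b, mul_one]
    exact hK _
  let D : ι → Ω → ℝ := fun b ω => fderiv ℝ g (quadVector w p q m fun r => X r ω)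
    (EuclideanSpace.basisFun ι ℝ b)
  let R : ν → Ω → ℝ := fun k ω => ∑ b, (w * ∑ l, (cov[X (p a k), X (p b l); P] * X (q b l) ω +
    X (p b l) ω * cov[X (p a k), X (q b l); P])) * D b ω
  have hR : ∀ k, MemLp (R k) 2 P := fun k => by
    refine memLp_finsetSum _ fun b _ => ?_
    have h1 : MemLp (fun ω => w * ∑ l, (cov[X (p a k), X (p b l); P] * X (q b l) ω +
        X (p b l) ω * cov[X (p a k), X (q b l); P])) 2 P :=
      (memLp_finsetSum _ fun l _ =>
        ((hX2 (q b l)).const_mul _).add ((hX2 (p b l)).mul_const _)).const_mul w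
    exact (hDb b).mul' h1
  have hRd : ∀ k ω, fderiv ℝ (fun x => g (quadVector w p q m x)) (fun r => X r ω)
      (fun r => cov[X (p a k), X r; P]) = R k ω := fun k ω => hd _ _
  have key : ∀ k, ∫ ω, (X (p a k) ω * X (q a k) ω - m a k) *
      g (quadVector w p q m fun r => X r ω) ∂P = ∫ ω, X (q a k) ω * R k ω ∂P := fun k => by
    have := integral_sub_mul_comp_gaussian hX h0 (p a k) (q a k) hgF hgm
      (by simp only [hRd]; exact hR k)
    simp only [hRd] at this
    exact this
  have hl : ∀ k, Integrable (fun ω => (X (p a k) ω * X (q a k) ω - m a k) *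
      g (quadVector w p q m fun r => X r ω)) P := fun k =>
    ((memLp_two_mul_gaussian hX (p a k) (q a k)).sub (memLp_const (m a k))).integrable_mul hgm
  have hr : ∀ k, Integrable (fun ω => X (q a k) ω * R k ω) P := fun k =>
    (hX2 (q a k)).integrable_mul (hR k)
  calc ∫ ω, quadVector w p q m (fun r => X r ω) a * g (quadVector w p q m fun r => X r ω) ∂P
      = ∫ ω, w * ∑ k, (X (p a k) ω * X (q a k) ω - m a k) *
          g (quadVector w p q m fun r => X r ω) ∂P := by
        refine integral_congr_ae (ae_of_all _ fun ω => ?_)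
        simp only [quadVector, mul_assoc, Finset.sum_mul]
    _ = ∫ ω, w * ∑ k, X (q a k) ω * R k ω ∂P := by
        rw [integral_const_mul, integral_const_mul, integral_finsetSum _ fun k _ => hl k,
          integral_finsetSum _ fun k _ => hr k]
        simp only [key]
    _ = _ := by
        refine integral_congr_ae (ae_of_all _ fun ω => ?_)
        simp only [R, D, Finset.mul_sum, Finset.sum_mul]
        rw [Finset.sum_comm]
        refine Finset.sum_congr rfl fun b _ => Finset.sum_congr rfl fun k _ =>
          Finset.sum_congr rfl fun l _ => ?_
        ring

end Kernels

/-! ### From Stein kernels to the two distances -/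

section Distances

/-- Jensen's inequality for the square root, read off from the nonnegativity of the variance of
`√f`. -/
lemma integral_sqrt_le {Ω : Type*} [MeasurableSpace Ω] {P : Measure Ω} [IsProbabilityMeasure P]
    {f : Ω → ℝ} (hf : Integrable f P) (hf0 : ∀ ω, 0 ≤ f ω) :
    Integrable (fun ω => √(f ω)) P ∧ ∫ ω, √(f ω) ∂P ≤ √(∫ ω, f ω ∂P) := by
  have hm : MemLp (fun ω => √(f ω)) 2 P := by
    refine (memLp_two_iff_integrable_sq
      (Real.continuous_sqrt.comp_aestronglyMeasurable hf.1)).2 ?_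
    simpa only [Real.sq_sqrt (hf0 _)] using hf
  refine ⟨hm.integrable (by norm_num), Real.le_sqrt_of_sq_le ?_⟩
  have h1 := variance_nonneg (fun ω => √(f ω)) P
  rw [variance_eq_sub hm] at h1
  have h2 : ∫ ω, ((fun ω => √(f ω)) ^ 2) ω ∂P = ∫ ω, f ω ∂P := by
    simp only [Pi.pow_apply, Real.sq_sqrt (hf0 _)]
  rw [h2] at h1
  linarith

variable {Ω Ω' ι : Type*} [MeasurableSpace Ω] [MeasurableSpace Ω'] [Fintype ι]

lemma EuclideanSpace.dual_apply_eq_sum (M : StrongDual ℝ (EuclideanSpace ℝ ι))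
    (x : EuclideanSpace ℝ ι) : M x = ∑ b, x b * M (EuclideanSpace.basisFun ι ℝ b) := by
  conv_lhs => rw [← (EuclideanSpace.basisFun ι ℝ).sum_repr x]
  simp

/-- The covariance matrix of a random vector is the mean of its Stein kernel. -/
lemma IsSteinKernel.covariance_eq {P : Measure Ω} [IsProbabilityMeasure P]
    {F : Ω → EuclideanSpace ℝ ι} {τ : ι → ι → Ω → ℝ} (hFk : IsSteinKernel F τ P)
    (hF : MemLp F 2 P) (a b : ι) :
    cov[fun ω => F ω a, fun ω => F ω b; P] = ∫ ω, τ a b ω ∂P := by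
  have hcoord : ∀ a, MemLp (fun ω => F ω a) 2 P := fun a => hF.eval_piLp a
  -- The test function `1` gives centering; the coordinate `x b` then gives the covariance.
  have h0 : ∫ ω, F ω a ∂P = 0 := by
    have := hFk a (fun _ => 1) contDiff_const ⟨0, fun x => by simp⟩
    simpa using this
  have h1 := hFk a (fun x => x b) (by fun_prop) ⟨‖(EuclideanSpace.proj b :
    EuclideanSpace ℝ ι →L[ℝ] ℝ)‖, fun x => by
      rw [show (fun x : EuclideanSpace ℝ ι => x b) = (EuclideanSpace.proj b :
        EuclideanSpace ℝ ι →L[ℝ] ℝ) from rfl, ContinuousLinearMap.fderiv]⟩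
  rw [covariance_eq_sub (hcoord a) (hcoord b), h0, zero_mul, sub_zero]
  refine h1.trans (integral_congr_ae (ae_of_all _ fun ω => ?_))
  classical
  simp only
  rw [show (fun x : EuclideanSpace ℝ ι => x b) = (EuclideanSpace.proj b :
        EuclideanSpace ℝ ι →L[ℝ] ℝ) from rfl, ContinuousLinearMap.fderiv]
  simp [EuclideanSpace.basisFun_apply]

variable {P : Measure Ω} [IsProbabilityMeasure P]
    {P' : Measure Ω'} [IsProbabilityMeasure P'] {F : Ω → EuclideanSpace ℝ ι}
    {Z : Ω' → EuclideanSpace ℝ ι} {τ : ι → ι → Ω → ℝ} {C : ι → ι → ℝ}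

lemma dist₂_le_of_isSteinKernel
    (hFk : IsSteinKernel F τ P) (hZk : IsSteinKernel Z (fun a b _ => C a b) P')
    (hF : MemLp F 2 P) (hZ : MemLp Z 2 P') (hτ : ∀ a b, MemLp (τ a b) 2 P) {v : ι → ι → ℝ}
    (hv : ∀ a b, ∫ ω, (τ a b ω - C a b) ^ 2 ∂P ≤ v a b) :
    dist₂ F P Z P' ≤ ENNReal.ofReal (Real.pi / 2 * ∑ a, ∑ b, √(v a b)) := by
  refine iSup_le fun h => iSup_le fun hh => iSup_le fun hs => ENNReal.ofReal_le_ofReal ?_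
  have hH : ∀ x i j, |fderiv ℝ (fderiv ℝ h) x (EuclideanSpace.basisFun ι ℝ i)
      (EuclideanSpace.basisFun ι ℝ j)| ≤ 1 := fun x i j => by
    have h1 := (le_iSup_of_le x (le_iSup_of_le i (le_iSup_of_le j le_rfl))).trans hs
    rwa [← ofReal_norm, ENNReal.ofReal_le_one] at h1
  -- This crude bound only ensures integrability in the interpolation; it does not enter the final
  -- estimate.
  have hK : ∀ x, ‖fderiv ℝ (fderiv ℝ h) x‖ ≤ (Fintype.card ι : ℝ) * Fintype.card ι := fun x => by
    refine ContinuousLinearMap.opNorm_le_bound₂ _ (by positivity) fun y z => ?_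
    have e : fderiv ℝ (fderiv ℝ h) x y z = ∑ i, ∑ j, y i * (z j *
        fderiv ℝ (fderiv ℝ h) x (EuclideanSpace.basisFun ι ℝ i)
          (EuclideanSpace.basisFun ι ℝ j)) := by
      conv_lhs => rw [← (EuclideanSpace.basisFun ι ℝ).sum_repr y]
      rw [map_sum, sum_apply]
      refine Finset.sum_congr rfl fun i _ => ?_
      rw [map_smul, smul_apply, EuclideanSpace.dual_apply_eq_sum _ z,
        ← Finset.mul_sum]
      simp
    rw [e]
    calc ‖∑ i, ∑ j, y i * (z j * fderiv ℝ (fderiv ℝ h) x (EuclideanSpace.basisFun ι ℝ i)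
          (EuclideanSpace.basisFun ι ℝ j))‖ ≤ ∑ i : ι, ∑ j : ι, ‖y‖ * ‖z‖ := by
          refine norm_sum_le_of_le _ fun i _ => norm_sum_le_of_le _ fun j _ => ?_
          rw [norm_mul, norm_mul]
          refine mul_le_mul (PiLp.norm_apply_le y i) ?_ (by positivity) (norm_nonneg _)
          exact (mul_le_of_le_one_right (norm_nonneg _) (hH x i j)).trans (PiLp.norm_apply_le z j)
      _ = _ := by simp; ring
  have hm : ∀ a b, MemLp (fun ω => τ a b ω - C a b) 2 P := fun a b => (hτ a b).sub (memLp_const _)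
  have hs : ∀ a b, Integrable (fun ω => |τ a b ω - C a b|) P ∧
      ∫ ω, |τ a b ω - C a b| ∂P ≤ √(v a b) := fun a b => by
    have h1 := integral_sqrt_le (hm a b).integrable_sq fun ω => sq_nonneg _
    simp only [Real.sqrt_sq_eq_abs] at h1
    exact ⟨h1.1, h1.2.trans (Real.sqrt_le_sqrt (hv a b))⟩
  refine (hFk.abs_integral_sub_le hZk hF hZ (fun a b => (hτ a b).integrable (by norm_num)) hh hK
    (D := fun ω => ∑ a, ∑ b, |τ a b ω - C a b|)
    (integrable_finsetSum _ fun a _ => integrable_finsetSum _ fun b _ => (hs a b).1)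
    fun ω x => ?_).trans ?_
  · refine (Finset.abs_sum_le_sum_abs _ _).trans (Finset.sum_le_sum fun a _ => ?_)
    refine (Finset.abs_sum_le_sum_abs _ _).trans (Finset.sum_le_sum fun b _ => ?_)
    rw [abs_mul]
    exact mul_le_of_le_one_right (abs_nonneg _) (hH x b a)
  · refine mul_le_mul_of_nonneg_left ?_ (by positivity)
    rw [integral_finsetSum _ fun a _ => integrable_finsetSum _ fun b _ => (hs a b).1]
    refine Finset.sum_le_sum fun a _ => ?_
    rw [integral_finsetSum _ fun b _ => (hs a b).1]
    exact Finset.sum_le_sum fun b _ => (hs a b).2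

lemma distTilde₂_le_of_isSteinKernel
    (hFk : IsSteinKernel F τ P) (hZk : IsSteinKernel Z (fun a b _ => C a b) P')
    (hF : MemLp F 2 P) (hZ : MemLp Z 2 P') (hτ : ∀ a b, MemLp (τ a b) 2 P) {v : ι → ι → ℝ}
    (hv : ∀ a b, ∫ ω, (τ a b ω - C a b) ^ 2 ∂P ≤ v a b) :
    distTilde₂ F P Z P' ≤ ENNReal.ofReal (Real.pi / 2 * ∑ b, √(∑ a, v a b)) := by
  refine iSup_le fun h => iSup_le fun hh => iSup_le fun hs => ENNReal.ofReal_le_ofReal ?_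
  have hK : ∀ x, ‖fderiv ℝ (fderiv ℝ h) x‖ ≤ 1 := fun x => by
    have h1 := (le_iSup_of_le x le_rfl).trans hs
    rwa [← ofReal_norm, ENNReal.ofReal_le_one] at h1
  have hm : ∀ a b, MemLp (fun ω => τ a b ω - C a b) 2 P := fun a b => (hτ a b).sub (memLp_const _)
  have hs : ∀ b, Integrable (fun ω => √(∑ a, (τ a b ω - C a b) ^ 2)) P ∧
      ∫ ω, √(∑ a, (τ a b ω - C a b) ^ 2) ∂P ≤ √(∑ a, v a b) := fun b => by
    have h1 := integral_sqrt_le (integrable_finsetSum Finset.univ fun a _ =>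
      (hm a b).integrable_sq) fun ω => Finset.sum_nonneg fun a _ => sq_nonneg _
    refine ⟨h1.1, h1.2.trans (Real.sqrt_le_sqrt ?_)⟩
    rw [integral_finsetSum _ fun a _ => (hm a b).integrable_sq]
    exact Finset.sum_le_sum fun a _ => hv a b
  refine (hFk.abs_integral_sub_le hZk hF hZ (fun a b => (hτ a b).integrable (by norm_num)) hh hK
    (D := fun ω => ∑ b, √(∑ a, (τ a b ω - C a b) ^ 2))
    (integrable_finsetSum _ fun b _ => (hs b).1) fun ω x => ?_).trans ?_
  · rw [Finset.sum_comm]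
    refine (Finset.abs_sum_le_sum_abs _ _).trans (Finset.sum_le_sum fun b _ => ?_)
    -- For fixed `b` the sum over `a` is the Hessian evaluated at `e_b` and the column `y`, so the
    -- operator norm bounds it by `‖y‖`.
    let y : EuclideanSpace ℝ ι := WithLp.toLp 2 fun a => τ a b ω - C a b
    have hy : ‖y‖ = √(∑ a, (τ a b ω - C a b) ^ 2) := by
      rw [EuclideanSpace.norm_eq]; simp [y]
    rw [← hy]
    refine (le_of_eq ?_).trans ((ContinuousLinearMap.le_opNorm₂ (fderiv ℝ (fderiv ℝ h) x)
      (EuclideanSpace.basisFun ι ℝ b) y).trans ?_)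
    · rw [EuclideanSpace.dual_apply_eq_sum _ y]; rfl
    · rw [(EuclideanSpace.basisFun ι ℝ).orthonormal.1 b, mul_one]
      exact mul_le_of_le_one_left (norm_nonneg _) (hK x)
  · refine mul_le_mul_of_nonneg_left ?_ (by positivity)
    rw [integral_finsetSum _ fun b _ => (hs b).1]
    exact Finset.sum_le_sum fun b _ => (hs b).2

end Distances

/-! ### Sums over closed walks of length four -/

section Cycles

lemma mul_four_le_quarter_sum (x y z w : ℝ) :
    x * y * z * w ≤ (x ^ 4 + y ^ 4 + z ^ 4 + w ^ 4) / 4 := by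
  nlinarith [sq_nonneg (x * y - z * w), sq_nonneg (x ^ 2 - y ^ 2), sq_nonneg (z ^ 2 - w ^ 2)]

variable {ν : Type*} [Fintype ν]

/-- Sum out the endpoint repeatedly: each step costs a factor `S`, and the starting point costs the
cardinality. -/
lemma sum_path_le {y₁ y₂ y₃ : ν → ν → ℝ} {S : ℝ} (hS : 0 ≤ S) (h₁ : ∀ k l, 0 ≤ y₁ k l)
    (h₂ : ∀ k l, 0 ≤ y₂ k l) (s₁ : ∀ k, ∑ l, y₁ k l ≤ S)
    (s₂ : ∀ k, ∑ l, y₂ k l ≤ S) (s₃ : ∀ k, ∑ l, y₃ k l ≤ S) :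
    ∑ i, ∑ j, ∑ k, ∑ l, y₁ i j * y₂ j k * y₃ k l ≤ Fintype.card ν * S ^ 3 := by
  calc ∑ i, ∑ j, ∑ k, ∑ l, y₁ i j * y₂ j k * y₃ k l
      ≤ ∑ i, ∑ j, ∑ k, y₁ i j * y₂ j k * S := by
        refine Finset.sum_le_sum fun i _ => Finset.sum_le_sum fun j _ =>
          Finset.sum_le_sum fun k _ => ?_
        rw [← Finset.mul_sum]
        exact mul_le_mul_of_nonneg_left (s₃ k) (mul_nonneg (h₁ _ _) (h₂ _ _))
    _ ≤ ∑ i, ∑ j, y₁ i j * S * S := by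
        refine Finset.sum_le_sum fun i _ => Finset.sum_le_sum fun j _ => ?_
        rw [← Finset.sum_mul, ← Finset.mul_sum]
        exact mul_le_mul_of_nonneg_right (mul_le_mul_of_nonneg_left (s₂ j) (h₁ _ _)) hS
    _ ≤ ∑ i : ν, S * S * S := by
        refine Finset.sum_le_sum fun i _ => ?_
        rw [← Finset.sum_mul, ← Finset.sum_mul]
        exact mul_le_mul_of_nonneg_right (mul_le_mul_of_nonneg_right (s₁ i) hS) hS
    _ = _ := by
        rw [Finset.sum_const, Finset.card_univ, nsmul_eq_mul]; ring

/-- A cyclic product of four matrices with nonnegative entries, summed over all closed walks of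
length four, is controlled by the `4/3`-power row sums. -/
lemma sum_cycle_le {a₁ a₂ a₃ a₄ : ν → ν → ℝ} {S : ℝ} (hS : 0 ≤ S) (h₁ : ∀ k l, 0 ≤ a₁ k l)
    (h₂ : ∀ k l, 0 ≤ a₂ k l) (h₃ : ∀ k l, 0 ≤ a₃ k l) (h₄ : ∀ k l, 0 ≤ a₄ k l)
    (s₁ : ∀ k, ∑ l, a₁ k l ^ (4 / 3 : ℝ) ≤ S) (s₂ : ∀ k, ∑ l, a₂ k l ^ (4 / 3 : ℝ) ≤ S)
    (s₃ : ∀ k, ∑ l, a₃ k l ^ (4 / 3 : ℝ) ≤ S) (s₄ : ∀ k, ∑ l, a₄ k l ^ (4 / 3 : ℝ) ≤ S) :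
    ∑ i, ∑ j, ∑ k, ∑ l, a₁ i j * a₂ j k * a₃ k l * a₄ l i ≤ Fintype.card ν * S ^ 3 := by
  have p3 : ∀ {x : ℝ}, 0 ≤ x → (x ^ (1 / 3 : ℝ)) ^ 3 = x := fun {x} hx => by
    rw [← Real.rpow_natCast, ← Real.rpow_mul hx]; norm_num
  have p4 : ∀ {x : ℝ}, 0 ≤ x → (x ^ (1 / 3 : ℝ)) ^ 4 = x ^ (4 / 3 : ℝ) := fun {x} hx => by
    rw [← Real.rpow_natCast, ← Real.rpow_mul hx]; norm_num
  have key : ∀ {x y z w : ℝ}, 0 ≤ x → 0 ≤ y → 0 ≤ z → 0 ≤ w → x * y * z * w ≤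
      (x ^ (4 / 3 : ℝ) * y ^ (4 / 3 : ℝ) * z ^ (4 / 3 : ℝ) +
       y ^ (4 / 3 : ℝ) * z ^ (4 / 3 : ℝ) * w ^ (4 / 3 : ℝ) +
       z ^ (4 / 3 : ℝ) * w ^ (4 / 3 : ℝ) * x ^ (4 / 3 : ℝ) +
       w ^ (4 / 3 : ℝ) * x ^ (4 / 3 : ℝ) * y ^ (4 / 3 : ℝ)) / 4 := fun {x y z w} hx hy hz hw => by
    rw [← p4 hx, ← p4 hy, ← p4 hz, ← p4 hw]
    conv_lhs => rw [← p3 hx, ← p3 hy, ← p3 hz, ← p3 hw]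
    generalize x ^ (1 / 3 : ℝ) = x'
    generalize y ^ (1 / 3 : ℝ) = y'
    generalize z ^ (1 / 3 : ℝ) = z'
    generalize w ^ (1 / 3 : ℝ) = w'
    -- Each cube root occurs in three of the four triple products. The arithmetic-geometric
    -- inequality raises these to the fourth power, which is the source of the exponent `4/3`, and
    -- dropping one factor opens the cycle into a path.
    calc _ = (x' * y' * z') * (y' * z' * w') * (z' * w' * x') * (w' * x' * y') := by ring
      _ ≤ _ := mul_four_le_quarter_sum _ _ _ _
      _ = _ := by ring
  have n : ∀ {a : ν → ν → ℝ}, (∀ k l, 0 ≤ a k l) → ∀ k l, 0 ≤ a k l ^ (4 / 3 : ℝ) :=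
    fun h k l => Real.rpow_nonneg (h k l) _
  have b₁ := sum_path_le hS (n h₁) (n h₂) s₁ s₂ s₃
  have b₂ := sum_path_le hS (n h₂) (n h₃) s₂ s₃ s₄
  have b₃ := sum_path_le hS (n h₃) (n h₄) s₃ s₄ s₁
  have b₄ := sum_path_le hS (n h₄) (n h₁) s₄ s₁ s₂
  have rot : ∀ f : ν → ν → ν → ν → ℝ,
      ∑ i, ∑ j, ∑ k, ∑ l, f j k l i = ∑ i, ∑ j, ∑ k, ∑ l, f i j k l := fun f => by
    rw [Finset.sum_comm]
    refine Finset.sum_congr rfl fun j _ => ?_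
    rw [Finset.sum_comm]
    refine Finset.sum_congr rfl fun k _ => ?_
    rw [Finset.sum_comm]
  have r₂ := rot fun i j k l =>
    a₂ i j ^ (4 / 3 : ℝ) * a₃ j k ^ (4 / 3 : ℝ) * a₄ k l ^ (4 / 3 : ℝ)
  have r₃ := (rot fun i j k l =>
    a₃ j k ^ (4 / 3 : ℝ) * a₄ k l ^ (4 / 3 : ℝ) * a₁ l i ^ (4 / 3 : ℝ)).trans (rot fun i j k l =>
    a₃ i j ^ (4 / 3 : ℝ) * a₄ j k ^ (4 / 3 : ℝ) * a₁ k l ^ (4 / 3 : ℝ))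
  have r₄ := rot fun i j k l =>
    a₄ l i ^ (4 / 3 : ℝ) * a₁ i j ^ (4 / 3 : ℝ) * a₂ j k ^ (4 / 3 : ℝ)
  calc ∑ i, ∑ j, ∑ k, ∑ l, a₁ i j * a₂ j k * a₃ k l * a₄ l i
      ≤ ∑ i, ∑ j, ∑ k, ∑ l, (a₁ i j ^ (4 / 3 : ℝ) * a₂ j k ^ (4 / 3 : ℝ) * a₃ k l ^ (4 / 3 : ℝ) +
       a₂ j k ^ (4 / 3 : ℝ) * a₃ k l ^ (4 / 3 : ℝ) * a₄ l i ^ (4 / 3 : ℝ) +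
       a₃ k l ^ (4 / 3 : ℝ) * a₄ l i ^ (4 / 3 : ℝ) * a₁ i j ^ (4 / 3 : ℝ) +
       a₄ l i ^ (4 / 3 : ℝ) * a₁ i j ^ (4 / 3 : ℝ) * a₂ j k ^ (4 / 3 : ℝ)) / 4 :=
        Finset.sum_le_sum fun i _ => Finset.sum_le_sum fun j _ => Finset.sum_le_sum fun k _ =>
          Finset.sum_le_sum fun l _ => key (h₁ _ _) (h₂ _ _) (h₃ _ _) (h₄ _ _)
    _ ≤ _ := by
        simp only [← Finset.sum_div, Finset.sum_add_distrib]
        rw [r₂, r₃, ← r₄]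
        linarith

end Cycles

/-! ### The Wishart kernel and its variance -/

section Array

lemma sum_comp_le_of_injective {α β : Type*} [Fintype α] {φ : α → β}
    (hφ : Function.Injective φ) {t : Finset β} (ht : ∀ a, φ a ∈ t) {f : β → ℝ}
    (hf : ∀ b, 0 ≤ f b) : ∑ a, f (φ a) ≤ ∑ b ∈ t, f b := by
  classical
  rw [← Finset.sum_image (f := f) (g := φ) (s := Finset.univ) fun a _ b _ h => hφ h]
  refine Finset.sum_le_sum_of_subset_of_nonneg (fun b hb => ?_) fun b _ _ => hf b
  obtain ⟨a, -, rfl⟩ := Finset.mem_image.1 hb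
  exact ht a

variable {r s : ℤ → ℝ} {Ω : Type*} [MeasurableSpace Ω] {P : Measure Ω} {X : ℕ → ℕ → Ω → ℝ}

lemma sum_abs_sub_left_le (s : ℤ → ℝ) {d : ℕ} (k : Fin d) :
    ∑ l : Fin d, |s ((k : ℤ) - (l : ℤ))| ^ (4 / 3 : ℝ) ≤
      ∑ k ∈ Finset.Icc (-(d : ℤ)) (d : ℤ), |s k| ^ (4 / 3 : ℝ) := by
  refine sum_comp_le_of_injective (φ := fun l : Fin d => (k : ℤ) - (l : ℤ))
    (f := fun m => |s m| ^ (4 / 3 : ℝ)) (fun l m h => ?_) (fun l => ?_)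
    fun m => Real.rpow_nonneg (abs_nonneg _) _
  · simp only at h; ext; omega
  · have := k.2; have := l.2; simp only [Finset.mem_Icc]; omega

lemma sum_abs_sub_right_le (s : ℤ → ℝ) {d : ℕ} (k : Fin d) :
    ∑ l : Fin d, |s ((l : ℤ) - (k : ℤ))| ^ (4 / 3 : ℝ) ≤
      ∑ k ∈ Finset.Icc (-(d : ℤ)) (d : ℤ), |s k| ^ (4 / 3 : ℝ) := by
  refine sum_comp_le_of_injective (φ := fun l : Fin d => (l : ℤ) - (k : ℤ))
    (f := fun m => |s m| ^ (4 / 3 : ℝ)) (fun l m h => ?_) (fun l => ?_)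
    fun m => Real.rpow_nonneg (abs_nonneg _) _
  · simp only at h; ext; omega
  · have := k.2; have := l.2; simp only [Finset.mem_Icc]; omega

lemma WishartOverall.IsGaussianArray.hasGaussianLaw (h : IsGaussianArray P r s X) (n d : ℕ) :
    HasGaussianLaw (fun ω (p : Fin n × Fin d) => X p.1 p.2 ω) P := by
  classical
  let I : Finset (ℕ × ℕ) := Finset.univ.image fun p : Fin n × Fin d => ((p.1 : ℕ), (p.2 : ℕ))
  have hI : ∀ p : Fin n × Fin d, ((p.1 : ℕ), (p.2 : ℕ)) ∈ I := fun p =>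
    Finset.mem_image_of_mem _ (Finset.mem_univ p)
  exact (h.gaussian.hasGaussianLaw I).map_fun (ContinuousLinearMap.pi fun p : Fin n × Fin d =>
    ContinuousLinearMap.proj (R := ℝ) (φ := fun _ : I => ℝ) ⟨_, hI p⟩)

/-- The value `r (i - j)` is the correlation of two unit-variance entries of column `0`; expand `E
(X i 0 ± X j 0)² ≥ 0`. -/
lemma WishartOverall.IsGaussianArray.abs_le_one (h : IsGaussianArray P r s X) (hr : r 0 = 1)
    (hs : s 0 = 1) (i j : ℕ) : |r ((i : ℤ) - j)| ≤ 1 := by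
  have hG : ∀ i, HasGaussianLaw (X i 0) P := fun i => h.gaussian.hasGaussianLaw_eval (i, 0)
  have hm : ∀ i, MemLp (X i 0) 2 P := fun i => (hG i).memLp_two
  have hi : ∀ i j, Integrable (fun ω => X i 0 ω * X j 0 ω) P :=
    fun i j => (hm i).integrable_mul (hm j)
  have hc : ∀ i j : ℕ, ∫ ω, X i 0 ω * X j 0 ω ∂P = r ((i : ℤ) - j) := fun i j => by
    have := h.cov_eq i 0 j 0
    simpa [covariance, h.centered, hs] using this
  have h1 : ∀ i, ∫ ω, X i 0 ω * X i 0 ω ∂P = 1 := fun i => by rw [hc, sub_self, hr]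
  have h2 : Integrable (fun ω => X i 0 ω * X i 0 ω + X j 0 ω * X j 0 ω) P := (hi i i).add (hi j j)
  rw [← hc, abs_le]
  constructor
  · have : 0 ≤ ∫ ω, (X i 0 ω * X i 0 ω + X j 0 ω * X j 0 ω + 2 * (X i 0 ω * X j 0 ω)) ∂P :=
      integral_nonneg fun ω => by
        have := sq_nonneg (X i 0 ω + X j 0 ω)
        simp only [Pi.zero_apply]; linarith
    rw [integral_add h2 ((hi i j).const_mul 2),
      integral_add (hi i i) (hi j j), integral_const_mul, h1, h1] at this
    linarith
  · have : 0 ≤ ∫ ω, (X i 0 ω * X i 0 ω + X j 0 ω * X j 0 ω - 2 * (X i 0 ω * X j 0 ω)) ∂P :=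
      integral_nonneg fun ω => by
        have := sq_nonneg (X i 0 ω - X j 0 ω)
        simp only [Pi.zero_apply]; linarith
    rw [integral_sub h2 ((hi i j).const_mul 2),
      integral_add (hi i i) (hi j j), integral_const_mul, h1, h1] at this
    linarith

/-- The centered form `∑_{k,l < d} s (k - l) (X j k * X v l - r (j - v) * s (k - l))`. -/
noncomputable def crossForm (r s : ℤ → ℝ) (X : ℕ → ℕ → Ω → ℝ) (d j v : ℕ) (ω : Ω) : ℝ :=
  ∑ p : Fin d × Fin d, s ((p.1 : ℤ) - (p.2 : ℤ)) *
    (X j p.1 ω * X v p.2 ω - r ((j : ℤ) - v) * s ((p.1 : ℤ) - (p.2 : ℤ)))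

lemma memLp_crossForm (h : IsGaussianArray P r s X) (d j v : ℕ) :
    MemLp (crossForm r s X d j v) 2 P := by
  have := h.gaussian.isProbabilityMeasure
  have hm : ∀ i k, MemLp (X i k) 4 P := fun i k =>
    (h.gaussian.hasGaussianLaw_eval (i, k)).memLp (by norm_num)
  exact memLp_finsetSum _ fun p _ =>
    (((hm v p.2).mul' (hm j p.1)).sub (memLp_const _)).const_mul _

lemma integral_crossForm (h : IsGaussianArray P r s X) (d j v : ℕ) :
    ∫ ω, crossForm r s X d j v ω ∂P = 0 := by
  have := h.gaussian.isProbabilityMeasure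
  have hm : ∀ i k, MemLp (X i k) 2 P := fun i k =>
    (h.gaussian.hasGaussianLaw_eval (i, k)).memLp_two
  have hi : ∀ i k j l, Integrable (fun ω => X i k ω * X j l ω) P :=
    fun i k j l => (hm i k).integrable_mul (hm j l)
  have hi' : ∀ p : Fin d × Fin d, Integrable (fun ω => X j p.1 ω * X v p.2 ω -
      r ((j : ℤ) - v) * s ((p.1 : ℤ) - (p.2 : ℤ))) P :=
    fun p => (hi _ _ _ _).sub (integrable_const _)
  unfold crossForm
  rw [integral_finsetSum _ fun p _ => (hi' p).const_mul _]
  refine Finset.sum_eq_zero fun p _ => ?_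
  rw [integral_const_mul, integral_sub (hi _ _ _ _) (integrable_const _)]
  have := h.cov_eq j p.1 v p.2
  simp only [covariance, h.centered, sub_zero] at this
  simp [this]

lemma integral_crossForm_sq_le (h : IsGaussianArray P r s X) (hr : r 0 = 1) (hs : s 0 = 1)
    (d j v : ℕ) : ∫ ω, crossForm r s X d j v ω ^ 2 ∂P ≤
      2 * (d * (∑ k ∈ Finset.Icc (-(d : ℤ)) (d : ℤ), |s k| ^ (4 / 3 : ℝ)) ^ 3) := by
  have := h.gaussian.isProbabilityMeasure
  set S := ∑ k ∈ Finset.Icc (-(d : ℤ)) (d : ℤ), |s k| ^ (4 / 3 : ℝ) with hS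
  have hS0 : 0 ≤ S := Finset.sum_nonneg fun k _ => Real.rpow_nonneg (abs_nonneg _) _
  -- A finite block of rows containing both `j` and `v`.
  let n := max j v + 1
  have hX := h.hasGaussianLaw n d
  let J : Fin n := ⟨j, by omega⟩
  let V : Fin n := ⟨v, by omega⟩
  let Y : Fin n × Fin d → Ω → ℝ := fun p => X p.1 p.2
  have hc : ∀ p q : Fin n × Fin d, cov[Y p, Y q; P] =
      r ((p.1 : ℤ) - (q.1 : ℤ)) * s ((p.2 : ℤ) - (q.2 : ℤ)) := fun p q => h.cov_eq _ _ _ _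
  let g : Fin d × Fin d → Ω → ℝ := fun p ω =>
    Y (J, p.1) ω * Y (V, p.2) ω - cov[Y (J, p.1), Y (V, p.2); P]
  have hg : ∀ p, MemLp (g p) 2 P := fun p =>
    (memLp_two_mul_gaussian hX (J, p.1) (V, p.2)).sub (memLp_const _)
  have hJV : ∀ p : Fin d × Fin d, cov[Y (J, p.1), Y (V, p.2); P] =
      r ((j : ℤ) - v) * s ((p.1 : ℤ) - (p.2 : ℤ)) := fun p => hc _ _
  have hB : ∀ ω, crossForm r s X d j v ω ^ 2 = ∑ p : Fin d × Fin d, ∑ q : Fin d × Fin d,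
      s ((p.1 : ℤ) - (p.2 : ℤ)) * s ((q.1 : ℤ) - (q.2 : ℤ)) * (g p ω * g q ω) := fun ω => by
    rw [crossForm, sq, Finset.sum_mul_sum]
    refine Finset.sum_congr rfl fun p _ => Finset.sum_congr rfl fun q _ => ?_
    simp only [g, hJV, Y, J, V]
    ring
  have hgi : ∀ p q, Integrable (fun ω => s ((p.1 : ℤ) - (p.2 : ℤ)) * s ((q.1 : ℤ) - (q.2 : ℤ)) *
      (g p ω * g q ω)) P := fun p q => ((hg p).integrable_mul (hg q)).const_mul _
  simp only [hB]
  rw [integral_finsetSum _ fun p _ => integrable_finsetSum _ fun q _ => hgi p q]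
  -- Of the two Isserlis pairings, one carries `r 0 * r 0 = 1` and the other `r (j - v) * r (v -
  -- j)`, at most `1` in absolute value.
  have hterm : ∀ p q : Fin d × Fin d, ∫ ω, s ((p.1 : ℤ) - (p.2 : ℤ)) * s ((q.1 : ℤ) - (q.2 : ℤ)) *
      (g p ω * g q ω) ∂P ≤
      |s ((p.1 : ℤ) - (p.2 : ℤ))| * |s ((p.2 : ℤ) - (q.2 : ℤ))| * |s ((q.1 : ℤ) - (q.2 : ℤ))| *
        |s ((p.1 : ℤ) - (q.1 : ℤ))| +
      |s ((p.1 : ℤ) - (p.2 : ℤ))| * |s ((p.2 : ℤ) - (q.1 : ℤ))| * |s ((q.1 : ℤ) - (q.2 : ℤ))| *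
        |s ((p.1 : ℤ) - (q.2 : ℤ))| := fun p q => by
    have e := integral_sub_mul_mul_gaussian (X := Y) hX (fun p => h.centered _ _)
      (J, p.1) (V, p.2) (J, q.1) (V, q.2)
    rw [integral_const_mul, e]
    simp only [hc, sub_self, hr, one_mul]
    refine (le_abs_self _).trans ?_
    rw [mul_add]
    refine (abs_add_le _ _).trans (add_le_add (le_of_eq ?_) ?_)
    · simp only [abs_mul]; ring
    · simp only [abs_mul]
      have h1 := h.abs_le_one hr hs J V
      have h2 := h.abs_le_one hr hs V J
      calc _ = (|r (((J : ℕ) : ℤ) - ((V : ℕ) : ℤ))| * |r (((V : ℕ) : ℤ) - ((J : ℕ) : ℤ))|) *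
            (|s ((p.1 : ℤ) - (p.2 : ℤ))| * |s ((p.2 : ℤ) - (q.1 : ℤ))| *
              |s ((q.1 : ℤ) - (q.2 : ℤ))| * |s ((p.1 : ℤ) - (q.2 : ℤ))|) := by ring
        _ ≤ _ := mul_le_of_le_one_left (by positivity) (mul_le_one₀ h1 (abs_nonneg _) h2)
  have hcard : (Fintype.card (Fin d) : ℝ) = d := by simp
  refine (Finset.sum_le_sum fun p _ => (integral_finsetSum _ fun q _ => hgi p q).trans_le
    (Finset.sum_le_sum fun q _ => hterm p q)).trans ?_
  simp only [Finset.sum_add_distrib, Fintype.sum_prod_type]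
  rw [two_mul]
  refine add_le_add ?_ ?_
  -- The walk is `p.1, p.2, q.2, q.1`, hence the exchange of the two `q` sums below. Transposing
  -- `a₃` and `a₄` matches the signs of the differences without invoking evenness of `s`.
  · have := sum_cycle_le (ν := Fin d) (a₁ := fun k l => |s ((k : ℤ) - (l : ℤ))|)
      (a₂ := fun k l => |s ((k : ℤ) - (l : ℤ))|) (a₃ := fun k l => |s ((l : ℤ) - (k : ℤ))|)
      (a₄ := fun k l => |s ((l : ℤ) - (k : ℤ))|) hS0
      (fun _ _ => abs_nonneg _) (fun _ _ => abs_nonneg _) (fun _ _ => abs_nonneg _)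
      (fun _ _ => abs_nonneg _) (sum_abs_sub_left_le s) (sum_abs_sub_left_le s)
      (sum_abs_sub_right_le s) (sum_abs_sub_right_le s)
    rw [hcard] at this
    refine le_trans (le_of_eq ?_) this
    exact Finset.sum_congr rfl fun k _ => Finset.sum_congr rfl fun l _ => Finset.sum_comm
  · have := sum_cycle_le (ν := Fin d) (a₁ := fun k l => |s ((k : ℤ) - (l : ℤ))|)
      (a₂ := fun k l => |s ((k : ℤ) - (l : ℤ))|) (a₃ := fun k l => |s ((k : ℤ) - (l : ℤ))|)
      (a₄ := fun k l => |s ((l : ℤ) - (k : ℤ))|) hS0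
      (fun _ _ => abs_nonneg _) (fun _ _ => abs_nonneg _) (fun _ _ => abs_nonneg _)
      (fun _ _ => abs_nonneg _) (sum_abs_sub_left_le s) (sum_abs_sub_left_le s)
      (sum_abs_sub_left_le s) (sum_abs_sub_right_le s)
    rwa [hcard] at this

/-- The Stein kernel of the half vector of the shifted Wishart matrix. -/
noncomputable def wishartKernel (r s : ℤ → ℝ) (X : ℕ → ℕ → Ω → ℝ) (n d : ℕ) (a b : HalfIndex n)
    (ω : Ω) : ℝ :=
  1 / √d * ∑ k : Fin d, X a.1.2 k ω * (1 / √d * ∑ l : Fin d,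
    (r ((a.1.1 : ℤ) - (b.1.1 : ℤ)) * s ((k : ℤ) - (l : ℤ)) * X b.1.2 l ω +
      X b.1.1 l ω * (r ((a.1.1 : ℤ) - (b.1.2 : ℤ)) * s ((k : ℤ) - (l : ℤ)))))

lemma half_shiftedWishart_eq (h : IsGaussianArray P r s X) (hs : s 0 = 1) (n d : ℕ) (ω : Ω) :
    half (shiftedWishart r X n d) ω =
      quadVector (1 / √d) (fun (a : HalfIndex n) (k : Fin d) => (a.1.1, k))
        (fun a k => (a.1.2, k)) (fun a k => cov[X a.1.1 k, X a.1.2 k; P])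
        fun p : Fin n × Fin d => X p.1 p.2 ω := by
  ext a
  simp [half, shiftedWishart, quadVector, h.cov_eq, hs, Finset.sum_range]

lemma isSteinKernel_wishartKernel (h : IsGaussianArray P r s X) (hs : s 0 = 1) (n d : ℕ) :
    IsSteinKernel (half (shiftedWishart r X n d)) (wishartKernel r s X n d) P := by
  have h1 := isSteinKernel_quadVector (h.hasGaussianLaw n d) (fun p => h.centered _ _) (1 / √d)
    (fun (a : HalfIndex n) (k : Fin d) => (a.1.1, k)) (fun a k => (a.1.2, k))
  simp only [h.cov_eq] at h1
  rw [show half (shiftedWishart r X n d) = _ from funext (half_shiftedWishart_eq h hs n d)]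
  simp only [h.cov_eq]
  exact h1

lemma memLp_half_shiftedWishart (h : IsGaussianArray P r s X) (hs : s 0 = 1) (n d : ℕ) :
    MemLp (half (shiftedWishart r X n d)) 2 P := by
  rw [show half (shiftedWishart r X n d) = _ from funext (half_shiftedWishart_eq h hs n d)]
  exact memLp_quadVector (h.hasGaussianLaw n d) _ _ _ _

/-- The row correlations factor out of the double sum over columns. Since each `crossForm` is
centered for a Gaussian array, `c` is then the mean of the kernel. -/
lemma wishartKernel_eq {Ω : Type*} (r s : ℤ → ℝ) (X : ℕ → ℕ → Ω → ℝ) (n d : ℕ) (a b : HalfIndex n) :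
    ∃ c : ℝ, ∀ ω, wishartKernel r s X n d a b ω =
      1 / d * (r ((a.1.1 : ℤ) - (b.1.1 : ℤ)) * crossForm r s X d a.1.2 b.1.2 ω +
        r ((a.1.1 : ℤ) - (b.1.2 : ℤ)) * crossForm r s X d a.1.2 b.1.1 ω) + c := by
  refine ⟨1 / d * ∑ k : Fin d, ∑ l : Fin d, (r ((a.1.1 : ℤ) - (b.1.1 : ℤ)) *
    (s ((k : ℤ) - (l : ℤ)) * (r ((a.1.2 : ℤ) - (b.1.2 : ℤ)) * s ((k : ℤ) - (l : ℤ)))) +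
    r ((a.1.1 : ℤ) - (b.1.2 : ℤ)) * (s ((k : ℤ) - (l : ℤ)) *
      (r ((a.1.2 : ℤ) - (b.1.1 : ℤ)) * s ((k : ℤ) - (l : ℤ))))), fun ω => ?_⟩
  have hd : (1 / √d : ℝ) * (1 / √d) = 1 / d := by
    rw [div_mul_div_comm, one_mul, Real.mul_self_sqrt (Nat.cast_nonneg d)]
  rw [← hd]
  simp only [wishartKernel, crossForm, Fintype.sum_prod_type, Finset.mul_sum, mul_add,
    ← Finset.sum_add_distrib]
  refine Finset.sum_congr rfl fun k _ => Finset.sum_congr rfl fun l _ => ?_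
  ring

lemma memLp_wishartKernel (h : IsGaussianArray P r s X) (n d : ℕ) (a b : HalfIndex n) :
    MemLp (wishartKernel r s X n d a b) 2 P := by
  have := h.gaussian.isProbabilityMeasure
  obtain ⟨c, hc⟩ := wishartKernel_eq r s X n d a b
  rw [show wishartKernel r s X n d a b = _ from funext hc]
  exact ((((memLp_crossForm h _ _ _).const_mul _).add
    ((memLp_crossForm h _ _ _).const_mul _)).const_mul _).add (memLp_const _)

lemma integral_wishartKernel_sub_sq_le (h : IsGaussianArray P r s X) (hr : r 0 = 1) (hs : s 0 = 1)
    (n : ℕ) {d : ℕ} (hd : 1 ≤ d) (a b : HalfIndex n) :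
    ∫ ω, (wishartKernel r s X n d a b ω - ∫ ω', wishartKernel r s X n d a b ω' ∂P) ^ 2 ∂P ≤
      4 * (∑ k ∈ Finset.Icc (-(d : ℤ)) (d : ℤ), |s k| ^ (4 / 3 : ℝ)) ^ 3 / d *
        (r ((a.1.1 : ℤ) - (b.1.1 : ℤ)) ^ 2 + r ((a.1.1 : ℤ) - (b.1.2 : ℤ)) ^ 2) := by
  have := h.gaussian.isProbabilityMeasure
  set S := ∑ k ∈ Finset.Icc (-(d : ℤ)) (d : ℤ), |s k| ^ (4 / 3 : ℝ) with hS
  obtain ⟨c, hc⟩ := wishartKernel_eq r s X n d a b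
  set α := r ((a.1.1 : ℤ) - (b.1.1 : ℤ))
  set β := r ((a.1.1 : ℤ) - (b.1.2 : ℤ))
  set A := crossForm r s X d a.1.2 b.1.2 with hA
  set B := crossForm r s X d a.1.2 b.1.1 with hB
  have mA : MemLp A 2 P := memLp_crossForm h _ _ _
  have mB : MemLp B 2 P := memLp_crossForm h _ _ _
  have iA := (mA.integrable (by norm_num : (1 : ℝ≥0∞) ≤ 2)).const_mul α
  have iB := (mB.integrable (by norm_num : (1 : ℝ≥0∞) ≤ 2)).const_mul β
  have iAB : Integrable (fun ω => α * A ω + β * B ω) P := iA.add iB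
  have hmean : ∫ ω, wishartKernel r s X n d a b ω ∂P = c := by
    simp only [hc]
    rw [integral_add (iAB.const_mul _) (integrable_const _), integral_const_mul,
      integral_add iA iB, integral_const_mul, integral_const_mul, hA, hB, integral_crossForm h,
      integral_crossForm h]
    simp
  rw [hmean]
  simp only [hc, add_sub_cancel_right]
  have hd0 : (0 : ℝ) < d := by exact_mod_cast hd
  calc ∫ ω, (1 / d * (α * A ω + β * B ω)) ^ 2 ∂P
      ≤ ∫ ω, (2 / d ^ 2 * (α ^ 2 * A ω ^ 2 + β ^ 2 * B ω ^ 2)) ∂P := by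
        refine integral_mono (((mA.const_mul α).add (mB.const_mul β)).const_mul _).integrable_sq
          (((mA.integrable_sq.const_mul _).add (mB.integrable_sq.const_mul _)).const_mul _)
          fun ω => ?_
        calc (1 / d * (α * A ω + β * B ω)) ^ 2 = 1 / d ^ 2 * (α * A ω + β * B ω) ^ 2 := by ring
          _ ≤ 1 / d ^ 2 * (2 * (α ^ 2 * A ω ^ 2 + β ^ 2 * B ω ^ 2)) := by
            gcongr
            nlinarith [sq_nonneg (α * A ω - β * B ω)]
          _ = _ := by ring
    _ = 2 / d ^ 2 * (α ^ 2 * ∫ ω, A ω ^ 2 ∂P + β ^ 2 * ∫ ω, B ω ^ 2 ∂P) := by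
        rw [integral_const_mul, integral_add (mA.integrable_sq.const_mul _)
          (mB.integrable_sq.const_mul _), integral_const_mul, integral_const_mul]
    _ ≤ 2 / d ^ 2 * (α ^ 2 * (2 * (d * S ^ 3)) + β ^ 2 * (2 * (d * S ^ 3))) := by
        gcongr <;> exact integral_crossForm_sq_le h hr hs _ _ _
    _ = _ := by field_simp; ring

end Array

/-! ### Summation over matrix entries -/

section Rates

lemma sum_halfIndex_le {n : ℕ} {f : Fin n → Fin n → ℝ} (hf : ∀ i j, 0 ≤ f i j) :
    ∑ a : HalfIndex n, f a.1.1 a.1.2 ≤ ∑ i, ∑ j, f i j := by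
  rw [← Fintype.sum_prod_type']
  exact sum_comp_le_of_injective (φ := fun a : HalfIndex n => a.1) Subtype.val_injective
    (fun _ => Finset.mem_univ _) (f := fun p : Fin n × Fin n => f p.1 p.2) fun _ => hf _ _

lemma sum_fin_sub_le_tsum {f : ℤ → ℝ} (hf : ∀ m, 0 ≤ f m) (hs : Summable f) {n : ℕ} (u : Fin n) :
    ∑ i : Fin n, f ((i : ℤ) - (u : ℤ)) ≤ ∑' m, f m := by
  refine (sum_comp_le_of_injective (φ := fun i : Fin n => (i : ℤ) - (u : ℤ))
    (t := Finset.Icc (-(n : ℤ)) n) (fun i j h => ?_) (fun i => ?_) hf).trans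
    (hs.sum_le_tsum _ fun m _ => hf m)
  · simp only at h; ext; omega
  · have := u.2; have := i.2; simp only [Finset.mem_Icc]; omega

lemma sum_abs_le_sqrt_mul_sqrt {ι : Type*} [Fintype ι] (x : ι → ℝ) :
    ∑ i, |x i| ≤ √(Fintype.card ι) * √(∑ i, x i ^ 2) := by
  rw [← Real.sqrt_mul (Nat.cast_nonneg _)]
  refine Real.le_sqrt_of_sq_le ?_
  have := sq_sum_le_card_mul_sum_sq (s := Finset.univ) (f := fun i => |x i|)
  simpa [sq_abs, Finset.card_univ] using this

variable {r s : ℤ → ℝ} {Ω Ω' : Type*} [MeasurableSpace Ω] [MeasurableSpace Ω'] {P : Measure Ω}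
  {P' : Measure Ω'} {X : ℕ → ℕ → Ω → ℝ} {n d : ℕ} {G : Ω' → Matrix (Fin n) (Fin n) ℝ}

lemma WishartOverall.IsGaussianCounterpart.hasGaussianLaw_half {W : Ω → Matrix (Fin n) (Fin n) ℝ}
    (hG : IsGaussianCounterpart W P G P') : HasGaussianLaw (half G) P' :=
  hG.gaussian.map_fun ((PiLp.continuousLinearEquiv 2 ℝ
    fun _ : HalfIndex n => ℝ).symm.toContinuousLinearMap ∘L
    ContinuousLinearMap.pi fun a : HalfIndex n =>
      ContinuousLinearMap.proj (R := ℝ) (φ := fun _ : Fin n × Fin n => ℝ) a.1)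

/-- The kernel of a Gaussian vector is its covariance, which is shared with the Wishart entries and
so equals the mean of their kernel. -/
lemma isSteinKernel_half_counterpart (hs : s 0 = 1) (h : IsGaussianArray P r s X)
    (hG : IsGaussianCounterpart (shiftedWishart r X n d) P G P') :
    IsSteinKernel (half G) (fun a b _ => ∫ ω, wishartKernel r s X n d a b ω ∂P) P' := by
  have := h.gaussian.isProbabilityMeasure
  have h1 := isSteinKernel_covariance hG.hasGaussianLaw_half fun a => hG.centered _ _
  have h2 : ∀ a b : HalfIndex n, cov[fun ω => half G ω a, fun ω => half G ω b; P'] =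
      ∫ ω, wishartKernel r s X n d a b ω ∂P := fun a b =>
    (hG.cov_eq a.1.1 a.1.2 b.1.1 b.1.2).trans ((isSteinKernel_wishartKernel h hs n d).covariance_eq
      (memLp_half_shiftedWishart h hs n d) a b)
  simpa only [h2] using h1

lemma rate_eq (a : ℝ) (s : ℤ → ℝ) (n d : ℕ) : rate a s n d = (n : ℝ) ^ a *
    √((∑ k ∈ Finset.Icc (-(d : ℤ)) (d : ℤ), |s k| ^ (4 / 3 : ℝ)) ^ 3 / d) := by
  have hS : 0 ≤ ∑ k ∈ Finset.Icc (-(d : ℤ)) (d : ℤ), |s k| ^ (4 / 3 : ℝ) :=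
    Finset.sum_nonneg fun k _ => Real.rpow_nonneg (abs_nonneg _) _
  rw [rate, Real.sqrt_div' _ (Nat.cast_nonneg _), Real.sqrt_eq_rpow (_ ^ 3), ← Real.rpow_natCast,
    ← Real.rpow_mul hS]
  norm_num
  ring

/-- The distances between the half-matrices in terms of bounds on the row sums of `|r|`, `r²`. -/
lemma dist_half_shiftedWishart_le (hr : r 0 = 1) (hs : s 0 = 1) (h : IsGaussianArray P r s X)
    (hd : 1 ≤ d) (hG : IsGaussianCounterpart (shiftedWishart r X n d) P G P') {R₁ R₂ : ℝ}
    (h₁ : ∀ u : Fin n, ∑ i : Fin n, |r ((i : ℤ) - (u : ℤ))| ≤ R₁)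
    (h₂ : ∀ u : Fin n, ∑ i : Fin n, r ((i : ℤ) - (u : ℤ)) ^ 2 ≤ R₂) :
    dist₂ (half (shiftedWishart r X n d)) P (half G) P' ≤
        ENNReal.ofReal (7 * R₁ * rate 3 s n d) ∧
      distTilde₂ (half (shiftedWishart r X n d)) P (half G) P' ≤
        ENNReal.ofReal (7 * √R₂ * rate (5 / 2) s n d) := by
  have := h.gaussian.isProbabilityMeasure
  have := hG.hasGaussianLaw_half.isProbabilityMeasure
  have hFk := isSteinKernel_wishartKernel h hs n d
  have hZk := isSteinKernel_half_counterpart hs h hG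
  have hF := memLp_half_shiftedWishart h hs n d
  have hZ := hG.hasGaussianLaw_half.memLp_two
  have hτ := fun a b => memLp_wishartKernel h n d a b
  have hv := integral_wishartKernel_sub_sq_le h hr hs n hd
  -- The constant `7` is `7/4` times the `4` of the sums below.
  have hpi : Real.pi / 2 ≤ 7 / 4 := by have := Real.pi_lt_d2; linarith
  simp only [rate_eq]
  set S := ∑ k ∈ Finset.Icc (-(d : ℤ)) (d : ℤ), |s k| ^ (4 / 3 : ℝ) with hS
  have hS0 : 0 ≤ S := Finset.sum_nonneg fun k _ => Real.rpow_nonneg (abs_nonneg _) _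
  set ρ := √(S ^ 3 / d) with hρ
  have hρ0 : 0 ≤ ρ := Real.sqrt_nonneg _
  have hρ2 : 4 * S ^ 3 / d = (2 * ρ) ^ 2 := by
    rw [mul_pow, hρ, Real.sq_sqrt (by positivity)]; ring
  rw [hρ2] at hv
  constructor
  · refine (dist₂_le_of_isSteinKernel hFk hZk hF hZ hτ hv).trans (ENNReal.ofReal_le_ofReal ?_)
    have hroot : ∀ a b : HalfIndex n, √((2 * ρ) ^ 2 * (r ((a.1.1 : ℤ) - (b.1.1 : ℤ)) ^ 2 +
        r ((a.1.1 : ℤ) - (b.1.2 : ℤ)) ^ 2)) ≤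
        2 * ρ * (|r ((a.1.1 : ℤ) - (b.1.1 : ℤ))| + |r ((a.1.1 : ℤ) - (b.1.2 : ℤ))|) := fun a b => by
      refine Real.sqrt_le_iff.2 ⟨by positivity, ?_⟩
      rw [mul_pow (2 * ρ)]
      refine mul_le_mul_of_nonneg_left ?_ (sq_nonneg (2 * ρ))
      rw [add_sq, sq_abs, sq_abs]
      have := mul_nonneg (abs_nonneg (r ((a.1.1 : ℤ) - (b.1.1 : ℤ))))
        (abs_nonneg (r ((a.1.1 : ℤ) - (b.1.2 : ℤ))))
      linarith
    -- With `b` fixed, the first index of `a` runs over a row sum of `|r|`; its second index and the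
    -- two indices of `b` are free and give `n ^ 3`.
    have hsum : ∑ a : HalfIndex n, ∑ b : HalfIndex n,
        √((2 * ρ) ^ 2 * (r ((a.1.1 : ℤ) - (b.1.1 : ℤ)) ^ 2 +
          r ((a.1.1 : ℤ) - (b.1.2 : ℤ)) ^ 2)) ≤ 4 * ρ * (n ^ 3 * R₁) := by
      calc _ ≤ ∑ b : HalfIndex n, ∑ a : HalfIndex n,
            2 * ρ * (|r ((a.1.1 : ℤ) - (b.1.1 : ℤ))| + |r ((a.1.1 : ℤ) - (b.1.2 : ℤ))|) := by
            rw [Finset.sum_comm]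
            exact Finset.sum_le_sum fun b _ => Finset.sum_le_sum fun a _ => hroot a b
        _ ≤ ∑ b : HalfIndex n, ∑ i : Fin n, ∑ _j : Fin n,
            2 * ρ * (|r ((i : ℤ) - (b.1.1 : ℤ))| + |r ((i : ℤ) - (b.1.2 : ℤ))|) :=
            Finset.sum_le_sum fun b _ => sum_halfIndex_le (f := fun i _ =>
              2 * ρ * (|r ((i : ℤ) - (b.1.1 : ℤ))| + |r ((i : ℤ) - (b.1.2 : ℤ))|))
              fun _ _ => by positivity
        _ ≤ ∑ u : Fin n, ∑ v : Fin n, ∑ i : Fin n, ∑ _j : Fin n,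
            2 * ρ * (|r ((i : ℤ) - (u : ℤ))| + |r ((i : ℤ) - (v : ℤ))|) :=
            sum_halfIndex_le (f := fun u v => ∑ i : Fin n, ∑ _j : Fin n,
              2 * ρ * (|r ((i : ℤ) - (u : ℤ))| + |r ((i : ℤ) - (v : ℤ))|)) fun _ _ => by positivity
        _ ≤ ∑ u : Fin n, ∑ v : Fin n, n * (2 * ρ * (R₁ + R₁)) := by
            refine Finset.sum_le_sum fun u _ => Finset.sum_le_sum fun v _ => ?_
            simp only [Finset.sum_const, Finset.card_univ, Fintype.card_fin, nsmul_eq_mul,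
              ← Finset.mul_sum, Finset.sum_add_distrib]
            gcongr
            · exact h₁ u
            · exact h₁ v
        _ = _ := by
            simp only [Finset.sum_const, Finset.card_univ, Fintype.card_fin, nsmul_eq_mul]; ring
    have h0 : 0 ≤ 4 * ρ * (n ^ 3 * R₁) :=
      le_trans (Finset.sum_nonneg fun _ _ => Finset.sum_nonneg fun _ _ => Real.sqrt_nonneg _) hsum
    have h3 : (n : ℝ) ^ (3 : ℝ) = n ^ 3 := by norm_cast
    rw [h3]
    calc _ ≤ 7 / 4 * (4 * ρ * (n ^ 3 * R₁)) := by gcongr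
      _ = _ := by ring
  · refine (distTilde₂_le_of_isSteinKernel hFk hZk hF hZ hτ hv).trans
      (ENNReal.ofReal_le_ofReal ?_)
    have hcol : ∀ b : HalfIndex n, √(∑ a : HalfIndex n,
        (2 * ρ) ^ 2 * (r ((a.1.1 : ℤ) - (b.1.1 : ℤ)) ^ 2 + r ((a.1.1 : ℤ) - (b.1.2 : ℤ)) ^ 2)) ≤
        4 * ρ * (√n * √R₂) := fun b => by
      have hR₂ : 0 ≤ R₂ := (Finset.sum_nonneg fun _ _ => sq_nonneg _).trans (h₂ b.1.1)
      refine Real.sqrt_le_iff.2 ⟨by positivity, ?_⟩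
      calc _ ≤ ∑ i : Fin n, ∑ _j : Fin n,
            (2 * ρ) ^ 2 * (r ((i : ℤ) - (b.1.1 : ℤ)) ^ 2 + r ((i : ℤ) - (b.1.2 : ℤ)) ^ 2) :=
            sum_halfIndex_le (f := fun i _ => (2 * ρ) ^ 2 *
              (r ((i : ℤ) - (b.1.1 : ℤ)) ^ 2 + r ((i : ℤ) - (b.1.2 : ℤ)) ^ 2))
              fun _ _ => by positivity
        _ ≤ n * ((2 * ρ) ^ 2 * (R₂ + R₂)) := by
            simp only [Finset.sum_const, Finset.card_univ, Fintype.card_fin, nsmul_eq_mul,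
              ← Finset.mul_sum, Finset.sum_add_distrib]
            gcongr
            · exact h₂ b.1.1
            · exact h₂ b.1.2
        -- The constant `8` is enlarged to the perfect square `16`.
        _ ≤ 16 * ρ ^ 2 * (n * R₂) := by
            have : 0 ≤ ρ ^ 2 * (n * R₂) := by positivity
            linarith
        _ = _ := by
            rw [mul_pow, mul_pow, mul_pow, Real.sq_sqrt (Nat.cast_nonneg n), Real.sq_sqrt hR₂]; ring
    have h52 : (n : ℝ) ^ (5 / 2 : ℝ) = n ^ 2 * √n := by
      rw [show (5 / 2 : ℝ) = 2 + 1 / 2 by norm_num, Real.rpow_add_of_nonneg (Nat.cast_nonneg n)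
        (by norm_num) (by norm_num), ← Real.sqrt_eq_rpow]
      norm_cast
    rw [h52]
    have hsum : ∑ b : HalfIndex n, √(∑ a : HalfIndex n,
        (2 * ρ) ^ 2 * (r ((a.1.1 : ℤ) - (b.1.1 : ℤ)) ^ 2 + r ((a.1.1 : ℤ) - (b.1.2 : ℤ)) ^ 2)) ≤
        n ^ 2 * (4 * ρ * (√n * √R₂)) := by
      calc _ ≤ ∑ b : HalfIndex n, 4 * ρ * (√n * √R₂) := Finset.sum_le_sum fun b _ => hcol b
        _ ≤ ∑ u : Fin n, ∑ v : Fin n, 4 * ρ * (√n * √R₂) :=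
            sum_halfIndex_le (f := fun _ _ => 4 * ρ * (√n * √R₂)) fun _ _ => by positivity
        _ = _ := by
            simp only [Finset.sum_const, Finset.card_univ, Fintype.card_fin, nsmul_eq_mul]; ring
    calc _ ≤ 7 / 4 * (n ^ 2 * (4 * ρ * (√n * √R₂))) := by gcongr
      _ = _ := by ring

end Rates

/-! ### The three regimes for `r` -/

theorem mainTheorem4 :
    ∃ (C₁ : ℝ) (C₂ C₃ : (ℤ → ℝ) → ℝ),
      ∀ (r s : ℤ → ℝ), r 0 = 1 → s 0 = 1 → Memℓp s 2 →
      ∀ {Ω Ω' : Type*} [MeasurableSpace Ω] [MeasurableSpace Ω']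
        (P : Measure Ω) [IsProbabilityMeasure P] (P' : Measure Ω') [IsProbabilityMeasure P']
        (X : ℕ → ℕ → Ω → ℝ), IsGaussianArray P r s X →
      ∀ (n d : ℕ), 1 ≤ n → 1 ≤ d →
      ∀ (G : Ω' → Matrix (Fin n) (Fin n) ℝ),
        IsGaussianCounterpart (shiftedWishart r X n d) P G P' →
      (dist₂ (half (shiftedWishart r X n d)) P (half G) P' ≤
          ENNReal.ofReal (C₁ * rate 4 s n d) ∧
        distTilde₂ (half (shiftedWishart r X n d)) P (half G) P' ≤
          ENNReal.ofReal (C₁ * rate 3 s n d)) ∧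
      (Memℓp r 2 →
        dist₂ (half (shiftedWishart r X n d)) P (half G) P' ≤
          ENNReal.ofReal (C₂ r * rate (7 / 2) s n d) ∧
        distTilde₂ (half (shiftedWishart r X n d)) P (half G) P' ≤
          ENNReal.ofReal (C₂ r * rate (5 / 2) s n d)) ∧
      (Memℓp r 1 →
        dist₂ (half (shiftedWishart r X n d)) P (half G) P' ≤
          ENNReal.ofReal (C₃ r * rate 3 s n d) ∧
        distTilde₂ (half (shiftedWishart r X n d)) P (half G) P' ≤
          ENNReal.ofReal (C₃ r * rate (5 / 2) s n d)) := by

  -- `C₃` is a sum so that one constant serves both distances. The default value `0` of a divergent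
  -- `tsum` is harmless: `C₂` and `C₃` matter only when the series converge.
  refine ⟨7, fun r => 7 * √(∑' m, r m ^ 2), fun r => 7 * (∑' m, |r m| + √(∑' m, |r m|)), ?_⟩
  intro r s hr hs _ Ω Ω' _ _ P _ P' _ X h n d _ hd G hG
  have hrate : ∀ a, 0 ≤ rate a s n d := fun a => by rw [rate_eq]; positivity
  have hmul : ∀ (a b : ℝ), 0 ≤ a → 0 ≤ b → rate (a + b) s n d = (n : ℝ) ^ a * rate b s n d :=
    fun a b ha hb => by
      rw [rate_eq, rate_eq, Real.rpow_add_of_nonneg (Nat.cast_nonneg n) ha hb, mul_assoc]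
  have hone : ∀ i u : Fin n, |r ((i : ℤ) - (u : ℤ))| ≤ 1 := fun i u => h.abs_le_one hr hs i u
  have hsq : ∀ i u : Fin n, r ((i : ℤ) - (u : ℤ)) ^ 2 ≤ |r ((i : ℤ) - (u : ℤ))| := fun i u => by
    rw [← sq_abs, sq]
    exact mul_le_of_le_one_left (abs_nonneg _) (hone i u)
  have h₁ : ∀ u : Fin n, ∑ i : Fin n, |r ((i : ℤ) - (u : ℤ))| ≤ n := fun u =>
    (Finset.sum_le_sum fun i _ => hone i u).trans (by simp)
  refine ⟨?_, fun h2 => ?_, fun h1 => ?_⟩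
  -- Here `R₁ = R₂ = n`, from `r² ≤ |r| ≤ 1` at the relevant differences.
  · obtain ⟨hA, hB⟩ := dist_half_shiftedWishart_le hr hs h hd hG h₁ fun u =>
      (Finset.sum_le_sum fun i _ => hsq i u).trans (h₁ u)
    have e4 := hmul 1 3 (by norm_num) (by norm_num)
    have e3 := hmul (1 / 2) (5 / 2) (by norm_num) (by norm_num)
    rw [← Real.sqrt_eq_rpow] at e3
    norm_num at e4 e3
    rw [e3, e4, ← mul_assoc, ← mul_assoc]
    exact ⟨hA, hB⟩
  · have hsum : Summable fun m => r m ^ 2 := by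
      simpa using (memℓp_gen_iff (by norm_num : 0 < (2 : ℝ≥0∞).toReal)).1 h2
    have h₂ := sum_fin_sub_le_tsum (n := n) (fun m => sq_nonneg (r m)) hsum
    -- Cauchy-Schwarz gives `R₁ = √n √R₂` with `R₂ = ∑' r²`, which accounts for the extra `√n` in
    -- `d₂`.
    obtain ⟨hA, hB⟩ := dist_half_shiftedWishart_le hr hs h hd hG (fun u =>
      (sum_abs_le_sqrt_mul_sqrt fun i : Fin n => r ((i : ℤ) - (u : ℤ))).trans
        (mul_le_mul_of_nonneg_left (Real.sqrt_le_sqrt (h₂ u)) (Real.sqrt_nonneg _))) h₂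
    refine ⟨hA.trans_eq (congrArg ENNReal.ofReal ?_), hB⟩
    have e := hmul (1 / 2) 3 (by norm_num) (by norm_num)
    rw [← Real.sqrt_eq_rpow] at e
    norm_num at e
    rw [e, Fintype.card_fin]
    ring
  · have hsum : Summable fun m => |r m| := by
      simpa using (memℓp_gen_iff (by norm_num : 0 < (1 : ℝ≥0∞).toReal)).1 h1
    have h₁' := sum_fin_sub_le_tsum (n := n) (fun m => abs_nonneg (r m)) hsum
    have ht : 0 ≤ ∑' m, |r m| := tsum_nonneg fun m => abs_nonneg _
    -- Here `R₁ = R₂ = ∑' |r|`, again because `r² ≤ |r|` at these differences.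
    obtain ⟨hA, hB⟩ := dist_half_shiftedWishart_le hr hs h hd hG h₁' fun u =>
      (Finset.sum_le_sum fun i _ => hsq i u).trans (h₁' u)
    refine ⟨hA.trans (ENNReal.ofReal_le_ofReal (mul_le_mul_of_nonneg_right ?_ (hrate _))),
      hB.trans (ENNReal.ofReal_le_ofReal (mul_le_mul_of_nonneg_right ?_ (hrate _)))⟩
    · have := Real.sqrt_nonneg (∑' m, |r m|)
      linarith
    · linarith
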